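/- Let $R$ be a (noetherian) regular local ring of dimension $2$, with quotient field $F$, maximal ideal $\mathfrak m$ and residue field $K=R/\mathfrak m$. Let $R_v$ be a discrete valuation ring which dominates $R$ and has quotient field $F$; let $v$ be its normalized valuation, $K_v$ its residue field and $\mathrm{Res}_v:R_v\to K_v$ the residue map; $K$ is identified with its image in $K_v$. Let $z\in F$, $z\neq 0$, and suppose that $R_v$ is a dicritical divisor of $z$, that is, $z\in R_v$ and $\mathrm{Res}_v(z)$ is transcendental over $K$. Let $K'$ be the relative algebraic closure of $K$ in $K_v$. We say that $z$ is residually polynomial if there is $t\in K_v$, transcendental over $K$, such that $K_v=K'(t)$ and $\mathrm{Res}_v(z)\in K'[t]$. Let $(x,y)$ be a regular system of parameters of $R$ (that is, $\mathfrak m=(x,y)$), and let $a_0,b_0\in\mathbb N=\{0,1,2,\dots\}$ be such that $f:=zx^{a_0}y^{b_0}\in R$. Call $v$ monomial with respect to $(x,y)$ if $v(P)=\min\{a\,v(x)+b\,v(y)\mid\lambda_{a,b}\neq0\}$ for every finite sum $P=\sum_{a,b}\lambda_{a,b}x^ay^b$ whose nonzero coefficients $\lambda_{a,b}$ lie in $R\setminus\mathfrak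 m$. 1. If $v$ is not monomial with respect to $(x,y)$, then $z$ is residually polynomial. 2. Suppose that $v$ is monomial with respect to $(x,y)$. Then $\alpha:=v(x)$ and $\beta:=v(y)$ are positive integers, and with $\gamma:=a_0\alpha+b_0\beta$ one has $v(f)=\gamma$. Moreover $f$ has a finite expansion $$f=\sum_{a\alpha+b\beta\ge\gamma}\lambda_{a,b}x^ay^b,\qquad \lambda_{a,b}\in R,$$ and for every such expansion the finite set $$B_f:=\{b\in\mathbb N\mid \lambda_{a,b}\in R\setminus\mathfrak m\text{ for some }a\in\mathbb N\text{ with }a\alpha+b\beta=\gamma\}$$ is nonempty and the following hold. (a) If $|B_f|\ge2$, then $z$ is residually polynomial if and only if $b_0\le\min B_f$ or $b_0\ge\max B_f$. (b) If $B_f=\{b_1\}$, then $b_0\ne b_1$ and $z$ is residually polynomial. -/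

import Mathlib

open IsLocalRing

/-!
Throughout, `R` is a regular local ring of dimension two with quotient field `F`, and `V` is a
discrete valuation ring which dominates `R` (`R → V` is a local homomorphism, compatible with the
embeddings in `F`) and has the same quotient field `F`. The residue field `K` of `R` is identified
with its image in the residue field `K_v` of `V`.
-/

/-- The restriction to `R` of the normalized valuation `v` of the discrete valuation ring `V`. -/
noncomputable def divisorVal (R V : Type*) [CommRing R] [CommRing V] [IsDomain V]
    [IsDiscreteValuationRing V] [Algebra R V] (r : R) : ℕ∞ :=
  IsDiscreteValuationRing.addVal V (algebraMap R V r)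

/-- `z ∈ F` belongs to `V`, and its residue `Res_v(z)` is `ρ`. -/
def HasResidue (V : Type*) {F : Type*} [CommRing V] [IsLocalRing V] [Field F] [Algebra V F]
    (z : F) (ρ : ResidueField V) : Prop :=
  ∃ w : V, algebraMap V F w = z ∧ residue V w = ρ

/-- `V` is a dicritical divisor of `z`: `z ∈ V`, and `Res_v(z)` is transcendental over the residue
field `K` of `R`. -/
def IsDicriticalDivisor (R V : Type*) {F : Type*} [CommRing R] [IsLocalRing R] [CommRing V]
    [IsLocalRing V] [Algebra R V] [IsLocalHom (algebraMap R V)] [Field F] [Algebra V F]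
    (z : F) : Prop :=
  ∃ ρ : ResidueField V, HasResidue V z ρ ∧ Transcendental (ResidueField R) ρ

/-- The relative algebraic closure `K'` of the residue field `K` of `R` in the residue field `K_v`
of `V`. -/
noncomputable abbrev residueClosure (R V : Type*) [CommRing R] [IsLocalRing R] [CommRing V]
    [IsLocalRing V] [Algebra R V] [IsLocalHom (algebraMap R V)] :
    IntermediateField (ResidueField R) (ResidueField V) :=
  algebraicClosure (ResidueField R) (ResidueField V)

/-- An element `t` of `K_v`, transcendental over `K`, such that `K_v = K'(t)`. -/
def IsResidueGenerator (R V : Type*) [CommRing R] [IsLocalRing R] [CommRing V]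
    [IsLocalRing V] [Algebra R V] [IsLocalHom (algebraMap R V)] (t : ResidueField V) : Prop :=
  Transcendental (ResidueField R) t ∧
    IntermediateField.adjoin (residueClosure R V) {t} = ⊤

/-- `t` can be chosen (transcendental over `K`, with `K_v = K'(t)`) so that
`Res_v(z) ∈ K'[t]`. -/
def IsResiduallyPolynomial (R V : Type*) {F : Type*} [CommRing R] [IsLocalRing R] [CommRing V]
    [IsLocalRing V] [Algebra R V] [IsLocalHom (algebraMap R V)] [Field F] [Algebra V F]
    (z : F) : Prop :=
  ∃ t : ResidueField V, IsResidueGenerator R V t ∧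
    ∃ ρ : ResidueField V, HasResidue V z ρ ∧ ρ ∈ Algebra.adjoin (residueClosure R V) {t}

/-- The value `∑ λ_{a,b} x ^ a y ^ b` of a finite family of coefficients
`c (a, b) = λ_{a,b} ∈ R`. -/
noncomputable def monomialSum {R : Type*} [CommRing R] (x y : R) (c : ℕ × ℕ →₀ R) : R :=
  c.sum fun p l => l * x ^ p.1 * y ^ p.2

/-- `v` is monomial with respect to `(x, y)`: for every finite sum `P = ∑ λ_{a,b} x ^ a y ^ b` whose
nonzero coefficients are units of `R`, `v(P)` is the minimum of the `a v(x) + b v(y)` with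
`λ_{a,b} ≠ 0` (and `∞` for the empty sum). -/
def IsMonomialVal (R V : Type*) [CommRing R] [CommRing V] [IsDomain V]
    [IsDiscreteValuationRing V] [Algebra R V] (x y : R) : Prop :=
  ∀ c : ℕ × ℕ →₀ R, (∀ p ∈ c.support, IsUnit (c p)) →
    divisorVal R V (monomialSum x y c) =
      c.support.inf fun p => (p.1 : ℕ∞) * divisorVal R V x + (p.2 : ℕ∞) * divisorVal R V y

/-- `c` is the family of coefficients of an expansion
`f = ∑_{a α + b β ≥ γ} λ_{a,b} x ^ a y ^ b` with `λ_{a,b} ∈ R`. -/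
def IsExpansion {R : Type*} [CommRing R] (x y f : R) (α β γ : ℕ) (c : ℕ × ℕ →₀ R) : Prop :=
  (∀ p ∈ c.support, γ ≤ p.1 * α + p.2 * β) ∧ f = monomialSum x y c

open Classical in
/-- The set `B_f` of the `b` such that `λ_{a,b} ∈ R \ 𝔪` for some `a` with `a α + b β = γ`. -/
noncomputable def edgeExponents {R : Type*} [CommRing R] [IsLocalRing R] (α β γ : ℕ)
    (c : ℕ × ℕ →₀ R) : Finset ℕ :=
  (c.support.filter fun p => c p ∉ maximalIdeal R ∧ p.1 * α + p.2 * β = γ).image Prod.snd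

/-!
Write `K` for the residue field of `R`, `κ` for that of `V`, and `K'` for the algebraic closure of
`K` in `κ`.

*Toric divisors.* If `v` is monomial with respect to `(x, y)`, and `m, n` are coprime with `m v(y)
= n v(x)`, then `τ = y ^ m / x ^ n` is a unit of `V` whose residue `t` is transcendental over `K`
(`IsMonomialVal.exists_isToric`; the converse is `IsToric.isMonomialVal`). Two monomials of equal
value differ by a power of `τ`. Hence a sum of terms of value at least `v(x ^ a y ^ b)` is `x ^ a
y ^ b` times an element whose residue is a Laurent polynomial in `t`, with exponents recording the
powers of `y` (`IsToric.exists_leadingForm`). This gives `κ = K'(t)`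
(`IsDominated.adjoin_residue_eq_top`) and identifies the residue of `z = f / (x ^ a₀ y ^ b₀)` with
the leading form of `f` (`IsDominated.residue_eq_sum`). If all exponents are nonnegative, this
residue is a polynomial in `t`; if all are nonpositive, it is a polynomial in `t⁻¹`. If both signs
occur, the residue has poles at two places of `κ / K'`, namely at `t = 0` and `t = ∞`, whereas a
polynomial in a generator `s` has a pole only at the unique place at which `s` has one
(`sum_zpow_notMem_adjoin`).

*The other divisors.* Blow up the centre of `V`, say in the chart `y = x w`. The new local ring
`blowupRing` again has a maximal ideal with two generators, `x` and `g(w)`, where `g` lifts the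
minimal polynomial of the residue of `w` (`IsDominated.blowup`), and `z` is again a quotient with
a monomial denominator; the value of the numerator has dropped by `v(x)`, so that induction
applies. If `w` is a nonunit, then `g(w) = w`, and `V` is not toric for `(x, w)` because it is not
toric for `(x, y)`. If `w` is a unit, it becomes part of the numerator and the denominator is a
power of `x`; from then on either `V` is not toric, or it is toric with one exponent of the
denominator equal to zero, and then the leading form of the numerator has no negative exponents
(`isPolynomialResidue_of_not_toric`). If the residue of `w` is transcendental, then `V` is toric.

The induction needs of the local rings only the conditions collected in `IsDominated`, which makes
it unnecessary to show that a blow-up of a regular local ring is regular.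
-/

/-! ### Laurent polynomials in a generator of a rational function field -/

section LaurentSums

open Polynomial

variable {k L ι : Type*} [Field k] [Field L] [Algebra k L]

theorem ne_zero_of_transcendental {t : L} (ht : Transcendental k t) : t ≠ 0 := by
  rintro rfl
  exact ht isAlgebraic_zero

theorem coeff_eq_zero_of_sum_zpow_eq_zero {t : L} (ht : Transcendental k t)
    {s : Finset ι} {e : ι → ℤ} (he : Set.InjOn e s) {g : ι → k}
    (h : ∑ p ∈ s, algebraMap k L (g p) * t ^ e p = 0) {p : ι} (hp : p ∈ s) : g p = 0 := by
  have ht0 : t ≠ 0 := ne_zero_of_transcendental ht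
  -- clearing the negative exponents with a power of `t` gives a polynomial relation
  set N : ℕ := ∑ q ∈ s, (e q).natAbs
  have hN : ∀ q ∈ s, 0 ≤ e q + N := fun q hq ↦ by
    have := Finset.single_le_sum (f := fun q ↦ (e q).natAbs) (fun _ _ ↦ Nat.zero_le _) hq
    omega
  set P : k[X] := ∑ q ∈ s, monomial (e q + N).toNat (g q) with hP
  have hroot : aeval t P = 0 := by
    calc aeval t P = (∑ q ∈ s, algebraMap k L (g q) * t ^ e q) * t ^ (N : ℤ) := by
          rw [hP, map_sum, Finset.sum_mul]
          refine Finset.sum_congr rfl fun q hq ↦ ?_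
          rw [aeval_monomial, mul_assoc, ← zpow_add₀ ht0, ← zpow_natCast,
            Int.toNat_of_nonneg (hN q hq)]
      _ = 0 := by rw [h, zero_mul]
  have hP0 : P = 0 := transcendental_iff.mp ht P hroot
  have hc : P.coeff (e p + N).toNat = g p := by
    rw [hP, finsetSum_coeff, Finset.sum_eq_single p]
    · simp
    · intro q hq hqp
      rw [coeff_monomial, if_neg]
      intro hqe
      refine hqp (he hq hp ?_)
      have h1 := hN q hq
      have h2 := hN p hp
      omega
    · exact fun h ↦ (h hp).elim
  rw [← hc, hP0, coeff_zero]

theorem isTrivialOn_of_algebraMap_mem (O : ValuationSubring L)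
    (hO : ∀ a : k, algebraMap k L a ∈ O) : O.valuation.IsTrivialOn k := by
  refine ⟨fun a ha ↦ le_antisymm ((O.valuation_le_one_iff _).mpr (hO a)) ?_⟩
  have h1 := (O.valuation_le_one_iff _).mpr (hO a⁻¹)
  have h0 : algebraMap k L a ≠ 0 := by simpa using ha
  rw [map_inv₀] at h1
  exact (Valuation.one_le_val_iff _ h0).mpr h1

/-- A Laurent polynomial in `t` with a nonzero coefficient at a negative power of `t` has a pole at
every place, trivial on the constants, at which `t` vanishes. -/
theorem sum_zpow_notMem_valuationSubring (O : ValuationSubring L)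
    (hO : ∀ a : k, algebraMap k L a ∈ O) {t : L} (ht0 : t ≠ 0) (ht : t ∈ O.nonunits)
    {s : Finset ι} {e : ι → ℤ} (he : Set.InjOn e s) {g : ι → k}
    (hneg : ∃ p ∈ s, g p ≠ 0 ∧ e p < 0) :
    ∑ p ∈ s, algebraMap k L (g p) * t ^ e p ∉ O := by
  classical
  have hv : O.valuation t < 1 := (O.mem_nonunits_iff).mp ht
  have hv0 : 0 < O.valuation t := zero_lt_iff.mpr ((Valuation.ne_zero_iff _).mpr ht0)
  have hconst : ∀ a : k, a ≠ 0 → O.valuation (algebraMap k L a) = 1 :=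
    (isTrivialOn_of_algebraMap_mem O hO).eq_one
  obtain ⟨p₁, hp₁, hg₁, he₁⟩ := hneg
  obtain ⟨p, hp, hmin⟩ := Finset.exists_min_image (s.filter fun q ↦ g q ≠ 0) e
    ⟨p₁, Finset.mem_filter.mpr ⟨hp₁, hg₁⟩⟩
  obtain ⟨hps, hgp⟩ := Finset.mem_filter.mp hp
  have hep : e p < 0 := (hmin p₁ (Finset.mem_filter.mpr ⟨hp₁, hg₁⟩)).trans_lt he₁
  have hval : O.valuation (∑ q ∈ s, algebraMap k L (g q) * t ^ e q) = O.valuation t ^ e p := by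
    rw [Valuation.map_sum_eq_of_lt _ hps, map_mul, hconst _ hgp, one_mul, map_zpow₀]
    intro q hq
    simp only [Finset.mem_sdiff, Finset.mem_singleton] at hq
    rw [map_mul, map_mul, hconst _ hgp, one_mul, map_zpow₀, map_zpow₀]
    by_cases hgq : g q = 0
    · simpa [hgq] using zpow_pos hv0 _
    · rw [hconst _ hgq, one_mul]
      have hle := hmin q (Finset.mem_filter.mpr ⟨hq.1, hgq⟩)
      have hne : e p ≠ e q := fun h ↦ hq.2 (he hq.1 hps h.symm)
      exact zpow_lt_zpow_right_of_lt_one₀ hv0 hv (lt_of_le_of_ne hle hne)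
  rw [← O.valuation_le_one_iff, hval, not_le]
  exact one_lt_zpow_of_neg₀ hv0 hv hep

/-- There is a place of `L`, trivial on `k`, at which the transcendental element `t` vanishes. -/
theorem exists_valuationSubring_of_transcendental {t : L} (ht : Transcendental k t) :
    ∃ O : ValuationSubring L, (∀ a : k, algebraMap k L a ∈ O) ∧ t ∈ O.nonunits := by
  let A : Subring L := (Algebra.adjoin k {t}).toSubring
  have htA : t ∈ A := Algebra.subset_adjoin rfl
  have hI : Ideal.span {(⟨t, htA⟩ : A)} ≠ ⊤ := by
    rw [Ne, Ideal.span_singleton_eq_top, isUnit_iff_exists_inv]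
    rintro ⟨⟨b, hb⟩, hmul⟩
    have hmul' : t * b = 1 := congrArg Subtype.val hmul
    obtain ⟨Q, rfl⟩ : ∃ Q : k[X], aeval t Q = b := by
      have hb' : b ∈ Algebra.adjoin k {t} := hb
      rwa [Algebra.adjoin_singleton_eq_range_aeval] at hb'
    have hzero : aeval t (X * Q - 1) = 0 := by simp [hmul']
    have h0 := congrArg (fun P ↦ coeff P 0) (transcendental_iff.mp ht _ hzero)
    simp at h0
  obtain ⟨O, hAO, hIn⟩ := Ideal.image_subset_nonunits_valuationSubring _ hI
  refine ⟨O, fun a ↦ hAO ((Algebra.adjoin k {t}).algebraMap_mem a), ?_⟩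
  exact hIn ⟨⟨t, htA⟩, Ideal.subset_span rfl, rfl⟩

/-- The place at infinity of `k(s)` is unique: two places of `k(s)`, trivial on `k`, at which `s`
has a pole are equal. -/
theorem valuationSubring_le_of_pole {s : L} (hs : IntermediateField.adjoin k {s} = ⊤)
    (O₁ O₂ : ValuationSubring L) (h₁ : ∀ a : k, algebraMap k L a ∈ O₁)
    (h₂ : ∀ a : k, algebraMap k L a ∈ O₂) (hs₁ : s ∉ O₁) (hs₂ : s ∉ O₂) : O₁ ≤ O₂ := by
  -- at a pole of `s`, a fraction `P(s) / Q(s)` is integral exactly if `deg P ≤ deg Q`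
  have key : ∀ O : ValuationSubring L, (∀ a : k, algebraMap k L a ∈ O) → s ∉ O →
      ∀ P Q : k[X], P ≠ 0 → Q ≠ 0 →
        (aeval s P / aeval s Q ∈ O ↔ P.natDegree ≤ Q.natDegree) := by
    intro O hO hsO P Q hP hQ
    have := isTrivialOn_of_algebraMap_mem O hO
    have hlt : 1 < O.valuation s := by
      rw [← not_le, O.valuation_le_one_iff]
      exact hsO
    have hpos : 0 < O.valuation s ^ Q.natDegree := pow_pos (zero_lt_one.trans hlt) _
    rw [← O.valuation_le_one_iff, map_div₀,
      valuation_aeval_eq_valuation_X_pow_natDegree_of_one_lt_valuation_X s hlt hP,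
      valuation_aeval_eq_valuation_X_pow_natDegree_of_one_lt_valuation_X s hlt hQ,
      div_le_one₀ hpos, pow_le_pow_iff_right₀ hlt]
  intro w hw
  obtain ⟨P, Q, rfl⟩ := (IntermediateField.mem_adjoin_simple_iff k w).mp
    (hs ▸ IntermediateField.mem_top)
  by_cases hP : P = 0
  · simp [hP]
  by_cases hQ : Q = 0
  · simp [hQ]
  exact (key O₂ h₂ hs₂ P Q hP hQ).mpr ((key O₁ h₁ hs₁ P Q hP hQ).mp hw)

theorem mem_valuationSubring_of_mem_adjoin (O : ValuationSubring L)
    (hO : ∀ a : k, algebraMap k L a ∈ O) {s r : L} (hs : s ∈ O)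
    (hr : r ∈ Algebra.adjoin k {s}) : r ∈ O := by
  induction hr using Algebra.adjoin_induction with
  | mem x hx => rw [Set.mem_singleton_iff.mp hx]; exact hs
  | algebraMap a => exact hO a
  | add x y _ _ hx hy => exact add_mem hx hy
  | mul x y _ _ hx hy => exact mul_mem hx hy

/-- A Laurent polynomial in `t` with both negative and positive powers of `t` has two poles, hence
is not a polynomial in any generator `s` of `L = k(s)`. -/
theorem sum_zpow_notMem_adjoin {t : L} (ht : Transcendental k t)
    {s : Finset ι} {e : ι → ℤ} (he : Set.InjOn e s) {g : ι → k}
    (hneg : ∃ p ∈ s, g p ≠ 0 ∧ e p < 0) (hpos : ∃ p ∈ s, g p ≠ 0 ∧ 0 < e p)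
    {r : L} (hr : IntermediateField.adjoin k {r} = ⊤) :
    ∑ p ∈ s, algebraMap k L (g p) * t ^ e p ∉ Algebra.adjoin k {r} := by
  intro hmem
  have ht0 : t ≠ 0 := ne_zero_of_transcendental ht
  have hti : Transcendental k t⁻¹ := fun h ↦ ht (IsAlgebraic.inv_iff.mp h)
  obtain ⟨O₁, h₁, ht₁⟩ := exists_valuationSubring_of_transcendental ht
  obtain ⟨O₂, h₂, ht₂⟩ := exists_valuationSubring_of_transcendental hti
  have hr₁ : r ∉ O₁ := fun h ↦ sum_zpow_notMem_valuationSubring O₁ h₁ ht0 ht₁ he hneg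
    (mem_valuationSubring_of_mem_adjoin O₁ h₁ h hmem)
  have hr₂ : r ∉ O₂ := fun h ↦ by
    have := sum_zpow_notMem_valuationSubring O₂ h₂ (inv_ne_zero ht0) ht₂ (s := s)
      (e := fun p ↦ - e p) (fun p hp q hq h ↦ he hp hq (neg_injective h)) (g := g)
      (by simpa using hpos)
    simp only [inv_zpow, zpow_neg, inv_inv] at this
    exact this (mem_valuationSubring_of_mem_adjoin O₂ h₂ h hmem)
  have hle := valuationSubring_le_of_pole hr O₁ O₂ h₁ h₂ hr₁ hr₂
  rcases (O₂.mem_nonunits_iff_or).mp ht₂ with h | h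
  · exact inv_ne_zero ht0 h
  · rw [inv_inv] at h
    exact h (hle (O₁.nonunits_le ht₁))

theorem sum_zpow_mem_adjoin {t : L} {s : Finset ι} {e : ι → ℤ} {g : ι → k}
    (h : ∀ p ∈ s, g p ≠ 0 → 0 ≤ e p) :
    ∑ p ∈ s, algebraMap k L (g p) * t ^ e p ∈ Algebra.adjoin k {t} := by
  refine sum_mem fun p hp ↦ ?_
  by_cases hg : g p = 0
  · simp [hg]
  · obtain ⟨n, hn⟩ := Int.eq_ofNat_of_zero_le (h p hp hg)
    rw [hn, zpow_natCast]
    exact mul_mem (Subalgebra.algebraMap_mem _ _)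
      (pow_mem (Algebra.subset_adjoin (Set.mem_singleton t)) n)

theorem adjoin_inv_eq_top {t : L} (h : IntermediateField.adjoin k {t} = ⊤) :
    IntermediateField.adjoin k {t⁻¹} = ⊤ := by
  rw [eq_top_iff, ← h, IntermediateField.adjoin_simple_le_iff]
  simpa using inv_mem (IntermediateField.mem_adjoin_simple_self k t⁻¹)

end LaurentSums

/-! ### Local subrings dominated by the divisor, and toric divisors -/

section Toric

variable {V : Type*} [CommRing V] [IsDomain V] [IsDiscreteValuationRing V]

/-- The local ring `S`, with maximal ideal generated by `x` and `y`, is dominated by `V` via `φ`,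
has the same field of fractions as `V`, and has a residue field between `K` and the relative
algebraic closure of `K` in the residue field of `V`. No regularity of `S` is assumed. -/
structure IsDominated (K : Type*) [Field K] [Algebra K (ResidueField V)] {S : Type*} [CommRing S]
    (φ : S →+* V) (x y : S) : Prop where
  isUnit_of_map : ∀ r, IsUnit (φ r) → IsUnit r
  mem_span : ∀ r, ¬ IsUnit (φ r) → r ∈ Ideal.span {x, y}
  not_isUnit_left : ¬ IsUnit (φ x)
  not_isUnit_right : ¬ IsUnit (φ y)
  left_ne_zero : φ x ≠ 0
  right_ne_zero : φ y ≠ 0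
  exists_frac : ∀ u : V, ∃ p q : S, φ q ≠ 0 ∧ u * φ q = φ p
  residue_mem : ∀ r, residue V (φ r) ∈ algebraicClosure K (ResidueField V)
  exists_residue_eq : ∀ k : K, ∃ r, residue V (φ r) = algebraMap K (ResidueField V) k

/-- `V` is a toric divisor with respect to `x, y ∈ V`: for some coprime `m, n > 0`, the quotient
`τ = y ^ m / x ^ n` is a unit of `V` with transcendental residue. -/
structure IsToric (K : Type*) [Field K] [Algebra K (ResidueField V)] (x y : V) (m n : ℕ)
    (τ : Vˣ) : Prop where
  left_pos : 0 < m
  right_pos : 0 < n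
  coprime : m.Coprime n
  eq : y ^ m = τ * x ^ n
  transcendental : Transcendental K (residue V τ)

/-- The residue `ρ` is a polynomial in a suitable generator of the residue field of `V` over the
relative algebraic closure of `K`. -/
def IsPolynomialResidue (K : Type*) [Field K] [Algebra K (ResidueField V)]
    (ρ : ResidueField V) : Prop :=
  ∃ t : ResidueField V, (Transcendental K t ∧
    IntermediateField.adjoin (algebraicClosure K (ResidueField V)) {t} = ⊤) ∧
    ρ ∈ Algebra.adjoin (algebraicClosure K (ResidueField V)) {t}

open IsDiscreteValuationRing

theorem exists_addVal_eq_natCast {x : V} (hx : x ≠ 0) : ∃ n : ℕ, addVal V x = n := by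
  obtain ⟨n, hn⟩ := ENat.ne_top_iff_exists.mp (mt addVal_eq_top_iff.mp hx)
  exact ⟨n, hn.symm⟩

theorem pos_of_addVal_eq {x : V} {α : ℕ} (hx : ¬ IsUnit x) (hα : addVal V x = α) : 0 < α := by
  rcases Nat.eq_zero_or_pos α with rfl | h
  · exact (hx (addVal_eq_zero_iff.mp (by simpa using hα))).elim
  · exact h

theorem addVal_monomial {x y : V} {α β : ℕ} (hα : addVal V x = α) (hβ : addVal V y = β)
    (a b : ℕ) : addVal V (x ^ a * y ^ b) = (a * α + b * β : ℕ) := by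
  rw [addVal_mul, addVal_pow, addVal_pow, hα, hβ]
  simp

theorem ne_zero_of_addVal_eq {x : V} {α : ℕ} (hα : addVal V x = α) : x ≠ 0 := by
  rintro rfl
  simp at hα

theorem residue_eq_zero_iff_not_isUnit {u : V} : residue V u = 0 ↔ ¬ IsUnit u := by
  rw [residue_eq_zero_iff, mem_maximalIdeal, mem_nonunits_iff]

variable {K : Type*} [Field K] [Algebra K (ResidueField V)]

namespace IsToric

variable {x y : V} {m n : ℕ} {τ : Vˣ}

theorem symm (h : IsToric K x y m n τ) : IsToric K y x n m τ⁻¹ where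
  left_pos := h.right_pos
  right_pos := h.left_pos
  coprime := h.coprime.symm
  eq := by rw [h.eq, Units.inv_mul_cancel_left]
  transcendental := by
    intro hi
    refine h.transcendental (IsAlgebraic.inv_iff.mp ?_)
    convert hi
    refine inv_eq_of_mul_eq_one_right ?_
    rw [← map_mul, Units.mul_inv, map_one]

theorem mul_eq_mul (h : IsToric K x y m n τ) {α β : ℕ} (hα : addVal V x = α)
    (hβ : addVal V y = β) : m * β = n * α := by
  have h1 := congrArg (addVal V) h.eq
  rw [addVal_mul, addVal_pow, addVal_pow, hα, hβ, addVal_eq_zero_of_unit, zero_add] at h1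
  simp only [nsmul_eq_mul] at h1
  exact_mod_cast h1

theorem exists_monomial_eq_of_le (h : IsToric K x y m n τ) {α β : ℕ} (hα : addVal V x = α)
    (hβ : addVal V y = β) (hβ0 : 0 < β) {a b a₁ b₁ : ℕ}
    (hw : a * α + b * β = a₁ * α + b₁ * β) (hb : b₁ ≤ b) :
    ∃ i : ℕ, b = b₁ + i * m ∧ x ^ a * y ^ b = x ^ a₁ * y ^ b₁ * (τ : V) ^ i := by
  have hmul := h.mul_eq_mul hα hβ
  have hα0 : 0 < α := by
    rcases Nat.eq_zero_or_pos α with rfl | h0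
    · have := Nat.mul_pos h.left_pos hβ0
      omega
    · exact h0
  obtain ⟨d, rfl⟩ := Nat.exists_eq_add_of_le hb
  have ha : a ≤ a₁ := by
    by_contra hlt
    have : a₁ * α < a * α := Nat.mul_lt_mul_of_pos_right (not_le.mp hlt) hα0
    have : b₁ * β ≤ (b₁ + d) * β := Nat.mul_le_mul_right _ hb
    omega
  obtain ⟨e, rfl⟩ := Nat.exists_eq_add_of_le ha
  have hde : d * β = e * α := by
    have h1 : (b₁ + d) * β = b₁ * β + d * β := add_mul _ _ _
    have h2 : (a + e) * α = a * α + e * α := add_mul _ _ _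
    omega
  have hdn : d * n = e * m := by
    refine Nat.eq_of_mul_eq_mul_right hα0 ?_
    calc d * n * α = m * (d * β) := by rw [mul_assoc, ← hmul]; ring
      _ = e * m * α := by rw [hde]; ring
  obtain ⟨i, rfl⟩ : m ∣ d := h.coprime.dvd_of_dvd_mul_right ⟨e, by rw [hdn, mul_comm]⟩
  have he : e = i * n := by
    refine Nat.eq_of_mul_eq_mul_right h.left_pos ?_
    rw [← hdn]
    ring
  refine ⟨i, by rw [mul_comm], ?_⟩
  rw [he, pow_add, pow_mul, h.eq]
  ring

/-- Monomials of equal value differ by a power of the unit `τ`. -/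
theorem exists_monomial_eq (h : IsToric K x y m n τ) {α β : ℕ} (hα : addVal V x = α)
    (hβ : addVal V y = β) (hβ0 : 0 < β) {a b a₁ b₁ : ℕ}
    (hw : a * α + b * β = a₁ * α + b₁ * β) :
    ∃ i : ℤ, (b : ℤ) - b₁ = i * m ∧ x ^ a * y ^ b = x ^ a₁ * y ^ b₁ * ((τ ^ i : Vˣ) : V) := by
  rcases le_total b₁ b with hb | hb
  · obtain ⟨i, rfl, hi⟩ := h.exists_monomial_eq_of_le hα hβ hβ0 hw hb
    exact ⟨i, by push_cast; ring, by rw [hi]; simp⟩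
  · obtain ⟨i, rfl, hi⟩ := h.exists_monomial_eq_of_le hα hβ hβ0 hw.symm hb
    refine ⟨-i, by push_cast; ring, ?_⟩
    rw [hi, mul_assoc, ← Units.val_pow_eq_pow_val, ← Units.val_mul, zpow_neg, zpow_natCast,
      mul_inv_cancel, Units.val_one, mul_one]

/-- Two exponents of the same value with the same ratio are equal. -/
theorem exponent_injOn (h : IsToric K x y m n τ) {α β : ℕ} (hα : addVal V x = α)
    (hβ : addVal V y = β) (hα0 : 0 < α) (hβ0 : 0 < β) (a₁ b₁ : ℕ) :
    Set.InjOn (fun p : ℕ × ℕ ↦ ((p.2 : ℤ) - b₁) / m)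
      {p | p.1 * α + p.2 * β = a₁ * α + b₁ * β} := by
  intro p hp q hq hpq
  obtain ⟨i, hi, -⟩ := h.exists_monomial_eq hα hβ hβ0 hp
  obtain ⟨j, hj, -⟩ := h.exists_monomial_eq hα hβ hβ0 hq
  have hm : (m : ℤ) ≠ 0 := by have := h.left_pos; omega
  simp only [hi, hj, Int.mul_ediv_cancel _ hm] at hpq
  have h2 : p.2 = q.2 := by rw [hpq, ← hj] at hi; omega
  have h1 : p.1 = q.1 := by
    refine Nat.eq_of_mul_eq_mul_right hα0 ?_
    simp only [Set.mem_ofPred_eq, h2] at hp hq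
    omega
  exact Prod.ext h1 h2

/-- The leading form: a sum of terms of value at least that of `x ^ a₁ y ^ b₁` is `x ^ a₁ y ^ b₁`
times an element whose residue is the Laurent polynomial in the residue of `τ` formed by the
terms of equal value. -/
theorem exists_leadingForm {S : Type*} [CommRing S] {φ : S →+* V} {x y : S}
    (h : IsToric K (φ x) (φ y) m n τ) {α β : ℕ}
    (hα : addVal V (φ x) = α) (hβ : addVal V (φ y) = β) (hβ0 : 0 < β) (a₁ b₁ : ℕ)
    (c : ℕ × ℕ →₀ S) (hc : ∀ p ∈ c.support, a₁ * α + b₁ * β ≤ p.1 * α + p.2 * β) :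
    ∃ u : V, φ (monomialSum x y c) = φ x ^ a₁ * φ y ^ b₁ * u ∧
      residue V u = ∑ p ∈ c.support.filter (fun p ↦ p.1 * α + p.2 * β = a₁ * α + b₁ * β),
        residue V (φ (c p)) * residue V τ ^ (((p.2 : ℤ) - b₁) / m) := by
  have hm : (m : ℤ) ≠ 0 := by have := h.left_pos; omega
  have key : ∀ p ∈ c.support, ∃ u : V,
      φ (c p * x ^ p.1 * y ^ p.2) = φ x ^ a₁ * φ y ^ b₁ * u ∧
      residue V u = if p.1 * α + p.2 * β = a₁ * α + b₁ * β then
        residue V (φ (c p)) * residue V τ ^ (((p.2 : ℤ) - b₁) / m) else 0 := by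
    intro p hp
    split_ifs with hw
    · obtain ⟨i, hi, hmon⟩ := h.exists_monomial_eq hα hβ hβ0 hw
      refine ⟨φ (c p) * ((τ ^ i : Vˣ) : V), ?_, ?_⟩
      · rw [map_mul, map_mul, map_pow, map_pow, mul_assoc, hmon]
        ring
      · rw [hi, Int.mul_ediv_cancel _ hm, map_mul]
        congr 1
        have : residue V ((τ ^ i : Vˣ) : V) =
            ((Units.map (residue V : V →* ResidueField V) τ ^ i : (ResidueField V)ˣ) :
              ResidueField V) := by
          rw [← map_zpow]; rfl
        rw [this, Units.val_zpow_eq_zpow_val]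
        rfl
    · have hlt := lt_of_le_of_ne (hc p hp) (Ne.symm hw)
      have hv1 := addVal_monomial hα hβ p.1 p.2
      have hv2 := addVal_monomial hα hβ a₁ b₁
      obtain ⟨w, hw'⟩ : φ x ^ a₁ * φ y ^ b₁ ∣ φ x ^ p.1 * φ y ^ p.2 := by
        rw [← addVal_le_iff_dvd, hv1, hv2]
        exact_mod_cast hlt.le
      refine ⟨φ (c p) * w, ?_, ?_⟩
      · rw [map_mul, map_mul, map_pow, map_pow, mul_assoc, hw']
        ring
      · rw [map_mul, (residue_eq_zero_iff_not_isUnit (u := w)).mpr, mul_zero]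
        intro hu
        obtain ⟨w, rfl⟩ := hu
        rw [hw', addVal_mul, hv2, addVal_eq_zero_of_unit, add_zero] at hv1
        have : a₁ * α + b₁ * β = p.1 * α + p.2 * β := by exact_mod_cast hv1
        omega
  choose! u hu1 hu2 using key
  refine ⟨∑ p ∈ c.support, u p, ?_, ?_⟩
  · rw [monomialSum, Finsupp.sum, map_sum, Finset.mul_sum]
    exact Finset.sum_congr rfl hu1
  · rw [map_sum, Finset.sum_filter]
    exact Finset.sum_congr rfl hu2

end IsToric

namespace IsDominated

variable {S : Type*} [CommRing S] {φ : S →+* V} {x y : S}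

theorem symm (h : IsDominated K φ x y) : IsDominated K φ y x where
  isUnit_of_map := h.isUnit_of_map
  mem_span r hr := by rw [Set.pair_comm]; exact h.mem_span r hr
  not_isUnit_left := h.not_isUnit_right
  not_isUnit_right := h.not_isUnit_left
  left_ne_zero := h.right_ne_zero
  right_ne_zero := h.left_ne_zero
  exists_frac := h.exists_frac
  residue_mem := h.residue_mem
  exists_residue_eq := h.exists_residue_eq

variable {m n : ℕ} {τ : Vˣ} {α β : ℕ}

/-- The residue of the leading form vanishes only if all leading coefficients are nonunits. -/
theorem leadingForm_ne_zero (h : IsDominated K φ x y) (ht : IsToric K (φ x) (φ y) m n τ)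
    (hα : addVal V (φ x) = α) (hβ : addVal V (φ y) = β) (a₁ b₁ : ℕ)
    (c : ℕ × ℕ →₀ S) {p : ℕ × ℕ} (hp : p.1 * α + p.2 * β = a₁ * α + b₁ * β)
    (hcp : IsUnit (φ (c p))) :
    ∑ p ∈ c.support.filter (fun p ↦ p.1 * α + p.2 * β = a₁ * α + b₁ * β),
        residue V (φ (c p)) * residue V τ ^ (((p.2 : ℤ) - b₁) / m) ≠ 0 := by
  have hα0 := pos_of_addVal_eq h.not_isUnit_left hα
  have hβ0 := pos_of_addVal_eq h.not_isUnit_right hβ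
  intro h0
  have hp' : p ∈ c.support.filter fun p ↦ p.1 * α + p.2 * β = a₁ * α + b₁ * β := by
    rw [Finset.mem_filter, Finsupp.mem_support_iff]
    refine ⟨fun h0 ↦ ?_, hp⟩
    rw [h0, map_zero] at hcp
    exact not_isUnit_zero hcp
  have := coeff_eq_zero_of_sum_zpow_eq_zero (k := algebraicClosure K (ResidueField V))
    ht.transcendental.algebraicClosure
    (s := c.support.filter fun p ↦ p.1 * α + p.2 * β = a₁ * α + b₁ * β)
    (e := fun p ↦ ((p.2 : ℤ) - b₁) / m) (g := fun p ↦ ⟨residue V (φ (c p)), h.residue_mem _⟩)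
    ((ht.exponent_injOn hα hβ hα0 hβ0 a₁ b₁).mono fun q hq ↦ (Finset.mem_filter.mp hq).2)
    h0 hp'
  exact residue_eq_zero_iff_not_isUnit.mp (congrArg Subtype.val this) hcp

theorem addVal_monomialSum (h : IsDominated K φ x y) (ht : IsToric K (φ x) (φ y) m n τ)
    (hα : addVal V (φ x) = α) (hβ : addVal V (φ y) = β)
    (c : ℕ × ℕ →₀ S) {p : ℕ × ℕ} (hc : ∀ q ∈ c.support, p.1 * α + p.2 * β ≤ q.1 * α + q.2 * β)
    (hcp : IsUnit (φ (c p))) :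
    addVal V (φ (monomialSum x y c)) = (p.1 * α + p.2 * β : ℕ) := by
  have hβ0 := pos_of_addVal_eq h.not_isUnit_right hβ
  obtain ⟨u, hu, hres⟩ := ht.exists_leadingForm hα hβ hβ0 p.1 p.2 c hc
  have hne := h.leadingForm_ne_zero ht hα hβ p.1 p.2 c rfl hcp
  rw [← hres, Ne, residue_eq_zero_iff_not_isUnit, not_not] at hne
  obtain ⟨u, rfl⟩ := hne
  rw [hu, addVal_mul, addVal_monomial hα hβ, addVal_eq_zero_of_unit, add_zero]

/-- For a toric divisor, an element of value at least `N` is a sum of terms of value at least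
`N`. -/
theorem exists_isExpansion (h : IsDominated K φ x y) (ht : IsToric K (φ x) (φ y) m n τ)
    (hα : addVal V (φ x) = α) (hβ : addVal V (φ y) = β) (r : S) (N : ℕ)
    (hN : (N : ℕ∞) ≤ addVal V (φ r)) : ∃ c, IsExpansion x y r α β N c := by
  have hα0 := pos_of_addVal_eq h.not_isUnit_left hα
  have hβ0 := pos_of_addVal_eq h.not_isUnit_right hβ
  let I : ℕ → Ideal S := fun N ↦
    Ideal.span ((fun p : ℕ × ℕ ↦ x ^ p.1 * y ^ p.2) '' {p | N ≤ p.1 * α + p.2 * β})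
  have hI : ∀ {M : ℕ} {a b : ℕ}, M ≤ a * α + b * β → x ^ a * y ^ b ∈ I M := fun {M a b} hM ↦
    Ideal.subset_span ⟨(a, b), hM, rfl⟩
  have hmem : ∀ M s, s ∈ I M → ∃ c, IsExpansion x y s α β M c := by
    intro M s hs
    obtain ⟨c, hc, hcs⟩ := (Finsupp.mem_span_image_iff_linearCombination S).mp hs
    refine ⟨c, fun p hp ↦ hc hp, ?_⟩
    rw [← hcs, Finsupp.linearCombination_apply, monomialSum]
    simp only [smul_eq_mul, mul_assoc]
  refine hmem N r ?_
  induction N with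
  | zero => simpa using (I 0).mul_mem_left r (hI (M := 0) (a := 0) (b := 0) (Nat.zero_le _))
  | succ N ih =>
    obtain ⟨c, hc, hrc⟩ := hmem N r (ih (le_trans (by exact_mod_cast N.le_succ) hN))
    rw [hrc, monomialSum]
    refine sum_mem fun p hp ↦ ?_
    simp only
    rcases (hc p hp).lt_or_eq with hlt | heq
    · rw [mul_assoc]
      exact (I (N + 1)).mul_mem_left _ (hI hlt)
    · -- a unit coefficient in degree `N` would force the value of `r` to be `N`
      have hcp : ¬ IsUnit (φ (c p)) := by
        intro hu
        have := h.addVal_monomialSum ht hα hβ c (p := p) (fun q hq ↦ heq ▸ hc q hq) hu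
        rw [← hrc] at this
        rw [this, ← heq] at hN
        have : N + 1 ≤ N := by exact_mod_cast hN
        omega
      obtain ⟨a, b, hab⟩ := Ideal.mem_span_pair.mp (h.mem_span _ hcp)
      have h1 : x ^ (p.1 + 1) * y ^ p.2 ∈ I (N + 1) := hI (by rw [add_mul]; omega)
      have h2 : x ^ p.1 * y ^ (p.2 + 1) ∈ I (N + 1) := hI (by rw [add_mul]; omega)
      have : c p * x ^ p.1 * y ^ p.2 =
          a * (x ^ (p.1 + 1) * y ^ p.2) + b * (x ^ p.1 * y ^ (p.2 + 1)) := by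
        rw [← hab]
        ring
      rw [this]
      exact add_mem (Ideal.mul_mem_left _ _ h1) (Ideal.mul_mem_left _ _ h2)

/-- The leading form of a nonzero element of `S`: up to a fixed monomial of the same value, its
residue is in `K'(t)`, where `t` is the residue of `τ`. -/
theorem residue_mem_adjoin (h : IsDominated K φ x y) (ht : IsToric K (φ x) (φ y) m n τ)
    (hα : addVal V (φ x) = α) (hβ : addVal V (φ y) = β) (r : S) {a₁ b₁ : ℕ}
    (hr : addVal V (φ r) = (a₁ * α + b₁ * β : ℕ)) :
    ∃ u : V, φ r = φ x ^ a₁ * φ y ^ b₁ * u ∧ residue V u ∈ IntermediateField.adjoin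
      (algebraicClosure K (ResidueField V)) {residue V (τ : V)} := by
  have hβ0 := pos_of_addVal_eq h.not_isUnit_right hβ
  obtain ⟨c, hc, rfl⟩ := h.exists_isExpansion ht hα hβ r _ hr.ge
  obtain ⟨u, hu, hres⟩ := ht.exists_leadingForm hα hβ hβ0 a₁ b₁ c hc
  refine ⟨u, hu, ?_⟩
  rw [hres]
  refine sum_mem fun p _ ↦ mul_mem ?_ (zpow_mem (IntermediateField.mem_adjoin_simple_self _ _) _)
  exact IntermediateField.algebraMap_mem _
    (⟨_, h.residue_mem _⟩ : algebraicClosure K (ResidueField V))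

/-- The residue field of a toric divisor is generated by the residue of `τ`. -/
theorem adjoin_residue_eq_top (h : IsDominated K φ x y) (ht : IsToric K (φ x) (φ y) m n τ) :
    IntermediateField.adjoin (algebraicClosure K (ResidueField V)) {residue V (τ : V)} = ⊤ := by
  obtain ⟨α, hα⟩ := exists_addVal_eq_natCast h.left_ne_zero
  obtain ⟨β, hβ⟩ := exists_addVal_eq_natCast h.right_ne_zero
  rw [eq_top_iff]
  intro w _
  obtain ⟨u, rfl⟩ := residue_surjective w
  by_cases hu : IsUnit u
  swap
  · rw [residue_eq_zero_iff_not_isUnit.mpr hu]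
    exact zero_mem _
  obtain ⟨p, q, hq, hpq⟩ := h.exists_frac u
  have hvpq : addVal V (φ p) = addVal V (φ q) := by
    obtain ⟨u, rfl⟩ := hu
    rw [← hpq, addVal_mul, addVal_eq_zero_of_unit, zero_add]
  obtain ⟨N, hN⟩ := exists_addVal_eq_natCast hq
  -- the value of `q` is the value of a monomial, as otherwise `q` would have larger value
  obtain ⟨a₁, b₁, hab⟩ : ∃ a₁ b₁ : ℕ, a₁ * α + b₁ * β = N := by
    by_contra! hne
    obtain ⟨c, hc, hqc⟩ := h.exists_isExpansion ht hα hβ q N hN.ge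
    have hdvd : ((N + 1 : ℕ) : ℕ∞) ≤ addVal V (φ q) := by
      obtain ⟨π, hπ⟩ := IsDiscreteValuationRing.exists_irreducible V
      have hπN : ∀ M : ℕ, addVal V (π ^ M) = M := fun M ↦ hπ.addVal_pow M
      rw [← hπN, addVal_le_iff_dvd, hqc, monomialSum, Finsupp.sum, map_sum]
      refine Finset.dvd_sum fun p hp ↦ ?_
      rw [mul_assoc, map_mul]
      refine Dvd.dvd.mul_left ?_ _
      rw [← addVal_le_iff_dvd, hπN, map_mul, map_pow, map_pow, addVal_monomial hα hβ]
      exact_mod_cast lt_of_le_of_ne (hc p hp) (hne p.1 p.2).symm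
    rw [hN] at hdvd
    have : N + 1 ≤ N := by exact_mod_cast hdvd
    omega
  rw [hN, ← hab] at hvpq
  rw [← hab] at hN
  obtain ⟨u₁, hu₁, hr₁⟩ := h.residue_mem_adjoin ht hα hβ p hvpq
  obtain ⟨u₂, hu₂, hr₂⟩ := h.residue_mem_adjoin ht hα hβ q hN
  have hmon : φ x ^ a₁ * φ y ^ b₁ ≠ 0 := ne_zero_of_addVal_eq (addVal_monomial hα hβ a₁ b₁)
  have huu : u * u₂ = u₁ := by
    refine mul_left_cancel₀ hmon ?_
    rw [← hu₁, ← hpq, hu₂]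
    ring
  have hu₂' : residue V u₂ ≠ 0 := by
    rw [Ne, residue_eq_zero_iff_not_isUnit, not_not]
    by_contra hnu
    obtain ⟨k, hk⟩ := exists_addVal_eq_natCast (V := V) (x := u₂) (by
      rintro rfl
      exact hq (by rw [hu₂, mul_zero]))
    have hk0 := pos_of_addVal_eq hnu hk
    rw [hu₂, addVal_mul, addVal_monomial hα hβ, hk] at hN
    have : a₁ * α + b₁ * β + k = a₁ * α + b₁ * β := by exact_mod_cast hN
    omega
  rw [show residue V u = residue V u₁ / residue V u₂ by
    rw [eq_div_iff hu₂', ← map_mul, huu]]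
  exact div_mem hr₁ hr₂

/-- For a toric divisor, the residue of `z = f / (x ^ a₀ y ^ b₀)` is the leading form of `f`. -/
theorem residue_eq_sum (h : IsDominated K φ x y) (ht : IsToric K (φ x) (φ y) m n τ)
    (hα : addVal V (φ x) = α) (hβ : addVal V (φ y) = β) {z : V} {a₀ b₀ : ℕ} {f : S}
    (hf : φ f = z * φ x ^ a₀ * φ y ^ b₀) {c : ℕ × ℕ →₀ S}
    (hc : IsExpansion x y f α β (a₀ * α + b₀ * β) c) :
    residue V z = ∑ p ∈ c.support.filter (fun p ↦ p.1 * α + p.2 * β = a₀ * α + b₀ * β),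
        residue V (φ (c p)) * residue V τ ^ (((p.2 : ℤ) - b₀) / m) := by
  have hβ0 := pos_of_addVal_eq h.not_isUnit_right hβ
  obtain ⟨u, hu, hres⟩ := ht.exists_leadingForm hα hβ hβ0 a₀ b₀ c hc.1
  have hmon : φ x ^ a₀ * φ y ^ b₀ ≠ 0 := ne_zero_of_addVal_eq (addVal_monomial hα hβ a₀ b₀)
  rw [← hres]
  congr 1
  refine mul_left_cancel₀ hmon ?_
  rw [← hu, ← hc.2, hf]
  ring

/-- If all leading monomials of `f` have exponent of `y` at least `b₀`, then the residue of
`z = f / (x ^ a₀ y ^ b₀)` is a polynomial in the residue of `τ`. -/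
theorem isPolynomialResidue_of_le (h : IsDominated K φ x y) (ht : IsToric K (φ x) (φ y) m n τ)
    (hα : addVal V (φ x) = α) (hβ : addVal V (φ y) = β) {z : V} {a₀ b₀ : ℕ} {f : S}
    (hf : φ f = z * φ x ^ a₀ * φ y ^ b₀) {c : ℕ × ℕ →₀ S}
    (hc : IsExpansion x y f α β (a₀ * α + b₀ * β) c)
    (hb : ∀ p, p.1 * α + p.2 * β = a₀ * α + b₀ * β → IsUnit (φ (c p)) → b₀ ≤ p.2) :
    IsPolynomialResidue K (residue V z) := by
  refine ⟨residue V τ, ⟨ht.transcendental, h.adjoin_residue_eq_top ht⟩, ?_⟩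
  rw [h.residue_eq_sum ht hα hβ hf hc]
  refine sum_zpow_mem_adjoin (g := fun p ↦
    (⟨residue V (φ (c p)), h.residue_mem _⟩ : algebraicClosure K (ResidueField V))) ?_
  intro p hp hg
  have hu : IsUnit (φ (c p)) := by
    by_contra hu
    exact hg (Subtype.ext (residue_eq_zero_iff_not_isUnit.mpr hu))
  have := hb p (Finset.mem_filter.mp hp).2 hu
  exact Int.ediv_nonneg (by omega) (by omega)

theorem isPolynomialResidue_of_ge (h : IsDominated K φ x y) (ht : IsToric K (φ x) (φ y) m n τ)
    (hα : addVal V (φ x) = α) (hβ : addVal V (φ y) = β) {z : V} {a₀ b₀ : ℕ} {f : S}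
    (hf : φ f = z * φ x ^ a₀ * φ y ^ b₀) {c : ℕ × ℕ →₀ S}
    (hc : IsExpansion x y f α β (a₀ * α + b₀ * β) c)
    (hb : ∀ p, p.1 * α + p.2 * β = a₀ * α + b₀ * β → IsUnit (φ (c p)) → p.2 ≤ b₀) :
    IsPolynomialResidue K (residue V z) := by
  have hα0 := pos_of_addVal_eq h.not_isUnit_left hα
  have hβ0 := pos_of_addVal_eq h.not_isUnit_right hβ
  refine ⟨(residue V τ)⁻¹, ⟨fun hi ↦ ht.transcendental (IsAlgebraic.inv_iff.mp hi),
    adjoin_inv_eq_top (h.adjoin_residue_eq_top ht)⟩, ?_⟩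
  rw [h.residue_eq_sum ht hα hβ hf hc]
  have hmem := sum_zpow_mem_adjoin (t := (residue V (τ : V))⁻¹)
    (s := c.support.filter (fun p ↦ p.1 * α + p.2 * β = a₀ * α + b₀ * β))
    (e := fun p ↦ -(((p.2 : ℤ) - b₀) / m)) (g := fun p ↦
    (⟨residue V (φ (c p)), h.residue_mem _⟩ : algebraicClosure K (ResidueField V))) (by
      intro p hp hg
      have hu : IsUnit (φ (c p)) := by
        by_contra hu
        exact hg (Subtype.ext (residue_eq_zero_iff_not_isUnit.mpr hu))
      have := hb p (Finset.mem_filter.mp hp).2 hu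
      have hle : ((p.2 : ℤ) - b₀) / m ≤ 0 / m :=
        Int.ediv_le_ediv (by have := ht.left_pos; omega) (by omega)
      rw [Int.zero_ediv] at hle
      omega)
  simp only [inv_zpow, zpow_neg, inv_inv] at hmem
  exact hmem

/-- If some leading monomials of `f` have exponent of `y` less than `b₀` and some greater than
`b₀`, then the residue of `z = f / (x ^ a₀ y ^ b₀)` is not a polynomial. -/
theorem not_isPolynomialResidue (h : IsDominated K φ x y) (ht : IsToric K (φ x) (φ y) m n τ)
    (hα : addVal V (φ x) = α) (hβ : addVal V (φ y) = β) {z : V} {a₀ b₀ : ℕ} {f : S}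
    (hf : φ f = z * φ x ^ a₀ * φ y ^ b₀) {c : ℕ × ℕ →₀ S}
    (hc : IsExpansion x y f α β (a₀ * α + b₀ * β) c)
    (hlt : ∃ p, p.1 * α + p.2 * β = a₀ * α + b₀ * β ∧ IsUnit (φ (c p)) ∧ p.2 < b₀)
    (hgt : ∃ p, p.1 * α + p.2 * β = a₀ * α + b₀ * β ∧ IsUnit (φ (c p)) ∧ b₀ < p.2) :
    ¬ IsPolynomialResidue K (residue V z) := by
  have hα0 := pos_of_addVal_eq h.not_isUnit_left hα
  have hβ0 := pos_of_addVal_eq h.not_isUnit_right hβ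
  rintro ⟨t, ⟨-, htop⟩, hmem⟩
  rw [h.residue_eq_sum ht hα hβ hf hc] at hmem
  have hm : (m : ℤ) ≠ 0 := by have := ht.left_pos; omega
  have hmpos : (0 : ℤ) < m := by have := ht.left_pos; omega
  have key : ∀ p : ℕ × ℕ, p.1 * α + p.2 * β = a₀ * α + b₀ * β → IsUnit (φ (c p)) →
      p ∈ c.support.filter (fun p ↦ p.1 * α + p.2 * β = a₀ * α + b₀ * β) ∧
      (⟨residue V (φ (c p)), h.residue_mem _⟩ : algebraicClosure K (ResidueField V)) ≠ 0 ∧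
      (p.2 : ℤ) - b₀ = ((p.2 : ℤ) - b₀) / m * m := by
    intro p hp hu
    obtain ⟨i, hi, -⟩ := ht.exists_monomial_eq hα hβ hβ0 hp
    refine ⟨Finset.mem_filter.mpr ⟨Finsupp.mem_support_iff.mpr fun h0 ↦ ?_, hp⟩, fun h0 ↦ ?_, ?_⟩
    · rw [h0, map_zero] at hu
      exact not_isUnit_zero hu
    · exact residue_eq_zero_iff_not_isUnit.mp (congrArg Subtype.val h0) hu
    · rw [hi, Int.mul_ediv_cancel _ hm]
  refine sum_zpow_notMem_adjoin (k := algebraicClosure K (ResidueField V))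
    ht.transcendental.algebraicClosure
    (s := c.support.filter fun p ↦ p.1 * α + p.2 * β = a₀ * α + b₀ * β)
    (e := fun p ↦ ((p.2 : ℤ) - b₀) / m) (g := fun p ↦ ⟨residue V (φ (c p)), h.residue_mem _⟩)
    ((ht.exponent_injOn hα hβ hα0 hβ0 a₀ b₀).mono fun q hq ↦ (Finset.mem_filter.mp hq).2)
    ?_ ?_ htop hmem
  · obtain ⟨p, hp, hu, hpb⟩ := hlt
    obtain ⟨h1, h2, h3⟩ := key p hp hu
    refine ⟨p, h1, h2, ?_⟩
    by_contra hneg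
    have := mul_nonneg (not_lt.mp hneg) hmpos.le
    omega
  · obtain ⟨p, hp, hu, hpb⟩ := hgt
    obtain ⟨h1, h2, h3⟩ := key p hp hu
    refine ⟨p, h1, h2, ?_⟩
    by_contra hneg
    have := mul_nonpos_of_nonpos_of_nonneg (not_lt.mp hneg) hmpos.le
    omega

/-- For a toric divisor, a function with a power of `x` as denominator is residually
polynomial. -/
theorem isPolynomialResidue_of_toric (h : IsDominated K φ x y)
    (ht : IsToric K (φ x) (φ y) m n τ) {z : V} {a₀ : ℕ} {f : S}
    (hf : φ f = z * φ x ^ a₀) : IsPolynomialResidue K (residue V z) := by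
  obtain ⟨α, hα⟩ := exists_addVal_eq_natCast h.left_ne_zero
  obtain ⟨β, hβ⟩ := exists_addVal_eq_natCast h.right_ne_zero
  have hf' : φ f = z * φ x ^ a₀ * φ y ^ 0 := by rw [hf, pow_zero, mul_one]
  obtain ⟨c, hc⟩ := h.exists_isExpansion ht hα hβ f (a₀ * α + 0 * β) (by
    rw [hf', mul_assoc, addVal_mul, addVal_monomial hα hβ]
    exact le_add_self)
  exact h.isPolynomialResidue_of_le ht hα hβ hf' hc fun _ _ _ ↦ Nat.zero_le _

end IsDominated

end Toric

/-! ### Blowing up along the divisor -/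

section Blowup

open Polynomial IsDiscreteValuationRing

variable {V : Type*} [CommRing V]

/-- The localization of `S[w] ⊆ V` at the elements that are units of `V`. -/
def blowupRing {S : Type*} [CommRing S] (φ : S →+* V) (w : V) : Subring V where
  carrier := {u | ∃ P Q : S[X], IsUnit (Q.eval₂ φ w) ∧ u * Q.eval₂ φ w = P.eval₂ φ w}
  one_mem' := ⟨1, 1, by simp, by simp⟩
  zero_mem' := ⟨0, 1, by simp, by simp⟩
  mul_mem' := by
    rintro u v ⟨P, Q, hQ, hu⟩ ⟨P', Q', hQ', hv⟩
    refine ⟨P * P', Q * Q', ?_, ?_⟩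
    · rw [eval₂_mul]
      exact hQ.mul hQ'
    · rw [eval₂_mul, eval₂_mul, ← hu, ← hv]
      ring
  add_mem' := by
    rintro u v ⟨P, Q, hQ, hu⟩ ⟨P', Q', hQ', hv⟩
    refine ⟨P * Q' + P' * Q, Q * Q', ?_, ?_⟩
    · rw [eval₂_mul]
      exact hQ.mul hQ'
    · rw [eval₂_mul, eval₂_add, eval₂_mul, eval₂_mul, ← hu, ← hv]
      ring
  neg_mem' := by
    rintro u ⟨P, Q, hQ, hu⟩
    exact ⟨-P, Q, hQ, by rw [eval₂_neg, ← hu]; ring⟩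

theorem mem_blowupRing {S : Type*} [CommRing S] {φ : S →+* V} {w u : V} :
    u ∈ blowupRing φ w ↔
      ∃ P Q : S[X], IsUnit (Q.eval₂ φ w) ∧ u * Q.eval₂ φ w = P.eval₂ φ w :=
  Iff.rfl

theorem eval₂_mem_blowupRing {S : Type*} [CommRing S] (φ : S →+* V) (w : V) (P : S[X]) :
    P.eval₂ φ w ∈ blowupRing φ w :=
  mem_blowupRing.mpr ⟨P, 1, by simp, by simp⟩

theorem map_mem_blowupRing {S : Type*} [CommRing S] (φ : S →+* V) (w : V) (r : S) :
    φ r ∈ blowupRing φ w := by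
  simpa using eval₂_mem_blowupRing φ w (C r)

variable [IsDomain V] [IsDiscreteValuationRing V]

/-- If the maximal ideal of a local ring dominated by `V`, with the same fractions, is principal,
then every unit of `V` comes from that ring. -/
theorem exists_map_eq_of_principal {S : Type*} [CommRing S] {φ : S →+* V} {x : S}
    (hloc : ∀ r, IsUnit (φ r) → IsUnit r) (hspan : ∀ r, ¬ IsUnit (φ r) → r ∈ Ideal.span {x})
    (hx : ¬ IsUnit (φ x)) (hfrac : ∀ u : V, ∃ p q : S, φ q ≠ 0 ∧ u * φ q = φ p) {u : V}
    (hu : IsUnit u) : ∃ r, φ r = u := by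
  have hfac : ∀ N : ℕ, ∀ r, addVal V (φ r) = N →
      ∃ (i : ℕ) (r' : S), IsUnit r' ∧ φ r = φ x ^ i * φ r' := by
    intro N
    induction N using Nat.strong_induction_on with
    | _ N ih =>
      intro r hr
      by_cases hru : IsUnit (φ r)
      · exact ⟨0, r, hloc r hru, by simp⟩
      obtain ⟨a, rfl⟩ := Ideal.mem_span_singleton'.mp (hspan r hru)
      have hr0 := ne_zero_of_addVal_eq hr
      rw [map_mul] at hr0 hr
      obtain ⟨k, hk⟩ := exists_addVal_eq_natCast (left_ne_zero_of_mul hr0)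
      obtain ⟨l, hl⟩ := exists_addVal_eq_natCast (right_ne_zero_of_mul hr0)
      have hl0 := pos_of_addVal_eq hx hl
      rw [addVal_mul, hk, hl] at hr
      have hkl : k + l = N := by exact_mod_cast hr
      obtain ⟨i, r', hr', h⟩ := ih k (by omega) a hk
      exact ⟨i + 1, r', hr', by rw [map_mul, h]; ring⟩
  obtain ⟨p, q, hq, hpq⟩ := hfrac u
  have hp : φ p ≠ 0 := hpq ▸ mul_ne_zero hu.ne_zero hq
  obtain ⟨N, hN⟩ := exists_addVal_eq_natCast hp
  obtain ⟨M, hM⟩ := exists_addVal_eq_natCast hq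
  obtain ⟨j, p', hp', hpj⟩ := hfac N p hN
  obtain ⟨i, q', hq', hqi⟩ := hfac M q hM
  have hxi : φ x ^ i ≠ 0 := left_ne_zero_of_mul (hqi ▸ hq)
  have hxj : φ x ^ j ≠ 0 := left_ne_zero_of_mul (hpj ▸ hp)
  have hpow : ∀ d : ℕ, IsUnit (φ x ^ d) → d = 0 := fun d hd ↦ by
    by_contra hd0
    exact hx ((isUnit_pow_iff hd0).mp hd)
  rw [hqi, hpj] at hpq
  have huq : u * φ q' = φ p' := by
    rcases le_total i j with hij | hij
    · obtain ⟨d, rfl⟩ := Nat.exists_eq_add_of_le hij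
      have h1 : u * φ q' = φ x ^ d * φ p' := by
        refine mul_left_cancel₀ hxi ?_
        rw [← mul_assoc, ← mul_assoc, ← pow_add, ← hpq]
        ring
      have hd := hpow d (isUnit_of_mul_isUnit_left (h1 ▸ hu.mul (hq'.map φ)))
      rw [h1, hd, pow_zero, one_mul]
    · obtain ⟨d, rfl⟩ := Nat.exists_eq_add_of_le hij
      have h1 : u * φ q' * φ x ^ d = φ p' := by
        refine mul_left_cancel₀ hxj ?_
        rw [← hpq]
        ring
      have hd := hpow d (isUnit_of_mul_isUnit_right (h1 ▸ hp'.map φ))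
      rw [← h1, hd, pow_zero, mul_one]
  obtain ⟨q', rfl⟩ := hq'
  refine ⟨p' * (q'⁻¹ : Sˣ), ?_⟩
  rw [map_mul, ← huq, mul_assoc, ← map_mul, Units.mul_inv, map_one, mul_one]

variable {K : Type*} [Field K] [Algebra K (ResidueField V)]

namespace IsDominated

variable {S : Type*} [CommRing S] {φ : S →+* V} {x y : S}

theorem map_range (h : IsDominated K φ x y) :
    IsDominated K φ.range.subtype (φ.rangeRestrict x) (φ.rangeRestrict y) where
  isUnit_of_map := by
    rintro ⟨_, r, rfl⟩ hr
    exact (h.isUnit_of_map r hr).map φ.rangeRestrict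
  mem_span := by
    rintro ⟨_, r, rfl⟩ hr
    obtain ⟨a, b, rfl⟩ := Ideal.mem_span_pair.mp (h.mem_span r hr)
    refine Ideal.mem_span_pair.mpr ⟨φ.rangeRestrict a, φ.rangeRestrict b, ?_⟩
    rw [← map_mul, ← map_mul, ← map_add]
    rfl
  not_isUnit_left := h.not_isUnit_left
  not_isUnit_right := h.not_isUnit_right
  left_ne_zero := h.left_ne_zero
  right_ne_zero := h.right_ne_zero
  exists_frac u := by
    obtain ⟨p, q, h1, h2⟩ := h.exists_frac u
    exact ⟨φ.rangeRestrict p, φ.rangeRestrict q, h1, h2⟩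
  residue_mem := by
    rintro ⟨_, r, rfl⟩
    exact h.residue_mem r
  exists_residue_eq k := by
    obtain ⟨r, hr⟩ := h.exists_residue_eq k
    exact ⟨φ.rangeRestrict r, hr⟩

/-- In the chart `y = x w`, polynomials with nonunit coefficients become divisible by `x`. -/
theorem exists_eval₂_eq_mul (h : IsDominated K φ x y) {w : V} (hw : φ y = φ x * w) (P : S[X])
    (hP : ∀ i, ¬ IsUnit (φ (P.coeff i))) :
    ∃ Q : S[X], P.eval₂ φ w = φ x * Q.eval₂ φ w := by
  choose a b hab using fun i ↦ Ideal.mem_span_pair.mp (h.mem_span _ (hP i))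
  refine ⟨∑ i ∈ P.support, (C (a i) + C (b i) * X) * X ^ i, ?_⟩
  rw [eval₂_eq_sum, Polynomial.sum, eval₂_finsetSum, Finset.mul_sum]
  refine Finset.sum_congr rfl fun i _ ↦ ?_
  simp only [eval₂_mul, eval₂_add, eval₂_C, eval₂_X, eval₂_pow]
  rw [← hab i, map_add, map_mul, map_mul, hw]
  ring

/-- The blow-up of a dominated local ring at the centre of `V`, in the chart `y = x w`. Its maximal
ideal is generated by `x` and `g(w)`, where `g` cuts out the centre on the exceptional line. -/
theorem blowup (h : IsDominated K φ x y) {w : V} (hw : φ y = φ x * w)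
    (hres : residue V w ∈ algebraicClosure K (ResidueField V)) {g : S[X]}
    (hg : ¬ IsUnit (g.eval₂ φ w))
    (hdiv : ∀ P : S[X], ¬ IsUnit (P.eval₂ φ w) →
      ∃ Q T : S[X], P = g * Q + T ∧ ∀ i, ¬ IsUnit (φ (T.coeff i)))
    {ρ : ResidueField V} (hρ : Transcendental K ρ) :
    IsDominated K (blowupRing φ w).subtype ⟨φ x, map_mem_blowupRing φ w x⟩
      ⟨g.eval₂ φ w, eval₂_mem_blowupRing φ w g⟩ := by
  have hloc : ∀ u : blowupRing φ w, IsUnit ((blowupRing φ w).subtype u) → IsUnit u := by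
    rintro ⟨u, P, Q, hQ, hu⟩ ⟨v, rfl⟩
    have hP : IsUnit (P.eval₂ φ w) := hu ▸ v.isUnit.mul hQ
    refine isUnit_iff_exists_inv.mpr ⟨⟨(v⁻¹ : Vˣ), Q, P, hP, ?_⟩, Subtype.ext v.mul_inv⟩
    rw [← hu, Units.inv_mul_cancel_left]
  have hspan : ∀ u : blowupRing φ w, ¬ IsUnit ((blowupRing φ w).subtype u) →
      u ∈ Ideal.span {(⟨φ x, map_mem_blowupRing φ w x⟩ : blowupRing φ w),
        ⟨g.eval₂ φ w, eval₂_mem_blowupRing φ w g⟩} := by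
    rintro ⟨u, P, Q, hQ, hu⟩ hnu
    have hP : ¬ IsUnit (P.eval₂ φ w) := fun hP ↦ hnu (isUnit_of_mul_isUnit_left (hu ▸ hP))
    obtain ⟨A, T, rfl, hT⟩ := hdiv P hP
    obtain ⟨B, hB⟩ := h.exists_eval₂_eq_mul hw T hT
    obtain ⟨q, hq⟩ := hQ
    have hmem : ∀ D : S[X], D.eval₂ φ w * (q⁻¹ : Vˣ) ∈ blowupRing φ w := fun D ↦
      mem_blowupRing.mpr ⟨D, Q, ⟨q, hq⟩, by rw [← hq, Units.inv_mul_cancel_right]⟩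
    refine Ideal.mem_span_pair.mpr ⟨⟨_, hmem B⟩, ⟨_, hmem A⟩, Subtype.ext ?_⟩
    have hu' : u = (g * A + T).eval₂ φ w * (q⁻¹ : Vˣ) := by
      rw [← hu, ← hq, Units.mul_inv_cancel_right]
    rw [eval₂_add, eval₂_mul, hB] at hu'
    simp only [Subring.coe_add, Subring.coe_mul, hu']
    ring
  have hfrac : ∀ u : V, ∃ p q : blowupRing φ w, (blowupRing φ w).subtype q ≠ 0 ∧
      u * (blowupRing φ w).subtype q = (blowupRing φ w).subtype p := by
    intro u
    obtain ⟨p, q, hq, hpq⟩ := h.exists_frac u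
    exact ⟨⟨_, map_mem_blowupRing φ w p⟩, ⟨_, map_mem_blowupRing φ w q⟩, hq, hpq⟩
  have hmem : ∀ P : S[X], residue V (P.eval₂ φ w) ∈ algebraicClosure K (ResidueField V) := by
    intro P
    rw [eval₂_eq_sum, Polynomial.sum, map_sum]
    refine sum_mem fun i _ ↦ ?_
    rw [map_mul, map_pow]
    exact mul_mem (h.residue_mem _) (pow_mem hres i)
  have hresmem : ∀ u : blowupRing φ w,
      residue V ((blowupRing φ w).subtype u) ∈ algebraicClosure K (ResidueField V) := by
    rintro ⟨u, P, Q, hQ, hu⟩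
    have hQ0 : residue V (Q.eval₂ φ w) ≠ 0 := by
      rwa [Ne, residue_eq_zero_iff_not_isUnit, not_not]
    have : residue V u = residue V (P.eval₂ φ w) / residue V (Q.eval₂ φ w) := by
      rw [eq_div_iff hQ0, ← map_mul, hu]
    exact this ▸ div_mem (hmem P) (hmem Q)
  refine ⟨hloc, hspan, h.not_isUnit_left, hg, h.left_ne_zero, fun hg0 ↦ ?_, hfrac, hresmem, ?_⟩
  · -- if `g(w) = 0`, the maximal ideal is generated by `x` and all residues are algebraic over `K`
    have hspan' : ∀ u : blowupRing φ w, ¬ IsUnit ((blowupRing φ w).subtype u) →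
        u ∈ Ideal.span {(⟨φ x, map_mem_blowupRing φ w x⟩ : blowupRing φ w)} := by
      intro u hu
      obtain ⟨a, b, rfl⟩ := Ideal.mem_span_pair.mp (hspan u hu)
      refine Ideal.mem_span_singleton'.mpr ⟨a, Subtype.ext ?_⟩
      have hg0' : g.eval₂ φ w = 0 := hg0
      simp [hg0']
    obtain ⟨u, rfl⟩ := residue_surjective ρ
    have hu : IsUnit u := by
      by_contra hu
      exact ne_zero_of_transcendental hρ (residue_eq_zero_iff_not_isUnit.mpr hu)
    obtain ⟨r, rfl⟩ := exists_map_eq_of_principal hloc hspan' h.not_isUnit_left hfrac hu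
    exact hρ (mem_algebraicClosure_iff.mp (hresmem r))
  · intro k
    obtain ⟨r, hr⟩ := h.exists_residue_eq k
    exact ⟨⟨_, map_mem_blowupRing φ w r⟩, hr⟩

/-- If `w` is a nonunit, the centre of `V` on the exceptional line is the origin, cut out by `X`. -/
theorem exists_div_of_not_isUnit {w : V} (hw : ¬ IsUnit w) (P : S[X])
    (hP : ¬ IsUnit (P.eval₂ φ w)) :
    ∃ Q T : S[X], P = X * Q + T ∧ ∀ i, ¬ IsUnit (φ (T.coeff i)) := by
  refine ⟨P.divX, C (P.coeff 0), by rw [mul_comm, divX_mul_X_add], fun i ↦ ?_⟩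
  rw [coeff_C]
  split_ifs
  · rw [← residue_eq_zero_iff_not_isUnit] at hw hP ⊢
    rw [← divX_mul_X_add P, eval₂_add, eval₂_mul, eval₂_X, eval₂_C, map_add, map_mul, hw,
      mul_zero, zero_add] at hP
    simpa using hP
  · simp

/-- If the residue of `w` is algebraic over `K`, its minimal polynomial over the residue field of
`S` lifts to a monic polynomial over `S`, which cuts out the centre of `V` on the exceptional
line. -/
theorem exists_monic_div (h : IsDominated K φ x y) {w : V}
    (hres : residue V w ∈ algebraicClosure K (ResidueField V)) :
    ∃ g : S[X], ¬ IsUnit (g.eval₂ φ w) ∧ ∀ P : S[X], ¬ IsUnit (P.eval₂ φ w) →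
      ∃ Q T : S[X], P = g * Q + T ∧ ∀ i, ¬ IsUnit (φ (T.coeff i)) := by
  -- `κ` is the residue field of `S`, as a subfield of the residue field of `V`
  let κ : Subfield (ResidueField V) :=
    { ((residue V).comp φ).range with
      inv_mem' := by
        rintro _ ⟨r, rfl⟩
        by_cases hr : IsUnit (φ r)
        · obtain ⟨r, rfl⟩ := h.isUnit_of_map r hr
          refine ⟨(r⁻¹ : Sˣ), (inv_eq_of_mul_eq_one_right ?_).symm⟩
          rw [← map_mul, Units.mul_inv, map_one]
        · refine ⟨0, ?_⟩
          rw [RingHom.comp_apply, RingHom.comp_apply, residue_eq_zero_iff_not_isUnit.mpr hr]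
          simp }
  let φ' : S →+* κ := ((residue V).comp φ).codRestrict κ fun r ↦ ⟨r, rfl⟩
  have hφ' : Function.Surjective φ' := by
    rintro ⟨_, r, rfl⟩
    exact ⟨r, rfl⟩
  have hcomp : (algebraMap κ (ResidueField V)).comp φ' = (residue V).comp φ := rfl
  have heval : ∀ P : S[X], residue V (P.eval₂ φ w) = aeval (residue V w) (P.map φ') := by
    intro P
    rw [hom_eval₂, aeval_def, eval₂_map, hcomp]
  have hint : IsIntegral κ (residue V w) := by
    obtain ⟨P, hP, hP0⟩ := (mem_algebraicClosure_iff.mp hres).isIntegral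
    let j : K →+* κ := (algebraMap K (ResidueField V)).codRestrict κ fun k ↦
      (h.exists_residue_eq k).imp fun _ hr ↦ hr
    refine ⟨P.map j, hP.map j, ?_⟩
    rw [eval₂_map]
    exact hP0
  obtain ⟨g, hgmap, -, hg⟩ := lifts_and_natDegree_eq_and_monic
    ((lifts_iff_coeff_lifts (minpoly κ (residue V w))).mpr fun i ↦ hφ' _) (minpoly.monic hint)
  refine ⟨g, ?_, fun P hP ↦ ⟨P /ₘ g, P %ₘ g, ?_, fun i ↦ ?_⟩⟩
  · rw [← residue_eq_zero_iff_not_isUnit, heval, hgmap, minpoly.aeval]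
  · rw [add_comm, modByMonic_add_div]
  · rw [← residue_eq_zero_iff_not_isUnit, heval] at hP
    have h0 : (P %ₘ g).map φ' = 0 := by
      rw [map_modByMonic _ hg, hgmap, modByMonic_eq_zero_iff_dvd (minpoly.monic hint)]
      exact minpoly.dvd _ _ hP
    rw [← residue_eq_zero_iff_not_isUnit]
    have := congrArg (fun T ↦ (coeff T i : κ)) h0
    simp only [coeff_map, coeff_zero] at this
    exact congrArg Subtype.val this

end IsDominated

end Blowup

section Induction

open Polynomial IsDiscreteValuationRing

variable {V : Type*} [CommRing V] [IsDomain V] [IsDiscreteValuationRing V]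
  {K : Type*} [Field K] [Algebra K (ResidueField V)]

theorem IsToric.of_blowup {x y w : V} {m n : ℕ} {τ : Vˣ} (hw : y = x * w)
    (h : IsToric K x w m n τ) : IsToric K x y m (n + m) τ where
  left_pos := h.left_pos
  right_pos := Nat.add_pos_left h.right_pos m
  coprime := Nat.coprime_add_self_right.mpr h.coprime
  eq := by rw [hw, mul_pow, h.eq]; ring
  transcendental := h.transcendental

/-- A function `z = f / (x ^ a y ^ b)` is residually polynomial, provided that one of the exponents
vanishes if `V` is toric. By induction on the value of `f`, which drops under blowing up. After
blowing up at a point which is not on a coordinate line, only powers of `x` remain in the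
denominator. -/
theorem isPolynomialResidue_of_not_toric {z : V} (hz : Transcendental K (residue V z)) (N : ℕ) :
    ∀ (S : Subring V) (x y f : S) (a b : ℕ), IsDominated K S.subtype x y →
      (f : V) = z * x ^ a * y ^ b → addVal V (f : V) = N →
      ((∃ m n τ, IsToric K (x : V) (y : V) m n τ) → a = 0 ∨ b = 0) →
      IsPolynomialResidue K (residue V z) := by
  induction N using Nat.strong_induction_on with
  | _ N ih =>
  have key : ∀ (S : Subring V) (x y f : S) (a b : ℕ), IsDominated K S.subtype x y →
      (f : V) = z * x ^ a * y ^ b → addVal V (f : V) = N →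
      (¬ ∃ m n τ, IsToric K (x : V) (y : V) m n τ) → (x : V) ∣ y →
      IsPolynomialResidue K (residue V z) := by
    intro S x y f a b h hf hN hnt ⟨w, hw⟩
    have hx : ¬ IsUnit (x : V) := h.not_isUnit_left
    have hy : ¬ IsUnit (y : V) := h.not_isUnit_right
    have hx0 : (x : V) ≠ 0 := h.left_ne_zero
    have hab : a + b ≠ 0 := by
      intro hab
      obtain ⟨rfl, rfl⟩ : a = 0 ∧ b = 0 := by omega
      rw [pow_zero, pow_zero, mul_one, mul_one] at hf
      exact hz (mem_algebraicClosure_iff.mp (hf ▸ h.residue_mem f))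
    have hfu : ¬ IsUnit (f : V) := by
      intro hfu
      rw [hf] at hfu
      have hb : b = 0 := by
        by_contra hb
        exact hy ((isUnit_pow_iff hb).mp (isUnit_of_mul_isUnit_right hfu))
      have ha : a = 0 := by
        by_contra ha
        exact hx ((isUnit_pow_iff ha).mp
          (isUnit_of_mul_isUnit_right (isUnit_of_mul_isUnit_left hfu)))
      omega
    obtain ⟨d, hd⟩ := Nat.exists_eq_succ_of_ne_zero hab
    obtain ⟨p, q, hpq⟩ := Ideal.mem_span_pair.mp (h.mem_span f hfu)
    set P : S[X] := C p + C q * X with hP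
    have hfx : (f : V) = x * (z * (x : V) ^ d * w ^ b) := by
      rw [hf, hw]
      calc z * (x : V) ^ a * (x * w) ^ b = z * (x : V) ^ (a + b) * w ^ b := by ring
        _ = _ := by rw [hd, pow_succ]; ring
    have hPw : P.eval₂ S.subtype w = z * (x : V) ^ d * w ^ b := by
      refine mul_left_cancel₀ hx0 ?_
      rw [← hfx, ← hpq, Subring.coe_add, Subring.coe_mul, Subring.coe_mul, hw]
      simp only [hP, eval₂_add, eval₂_mul, eval₂_C, eval₂_X, Subring.subtype_apply]
      ring
    obtain ⟨α, hα⟩ := exists_addVal_eq_natCast hx0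
    have hα0 := pos_of_addVal_eq hx hα
    have hf0 : (f : V) ≠ 0 := ne_zero_of_addVal_eq hN
    by_cases hwu : IsUnit w
    · by_cases hwt : Transcendental K (residue V w)
      · obtain ⟨w, rfl⟩ := hwu
        exact (hnt ⟨1, 1, w, one_pos, one_pos, Nat.coprime_one_left 1,
          by rw [hw]; ring, hwt⟩).elim
      · have hres : residue V w ∈ algebraicClosure K (ResidueField V) :=
          mem_algebraicClosure_iff.mpr (not_not.mp hwt)
        obtain ⟨g, hg, hdiv⟩ := h.exists_monic_div hres
        have hdom := h.blowup hw hres hg hdiv hz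
        have hmem : z * (x : V) ^ d ∈ blowupRing S.subtype w := by
          refine mem_blowupRing.mpr ⟨P, X ^ b, ?_, ?_⟩
          · rw [eval₂_pow, eval₂_X]
            exact hwu.pow b
          · rw [eval₂_pow, eval₂_X, hPw]
        have hfx' : (f : V) = x * ((z * (x : V) ^ d) * w ^ b) := hfx
        obtain ⟨M, hM⟩ := exists_addVal_eq_natCast (V := V) (x := z * (x : V) ^ d) (by
          intro h0
          rw [h0, zero_mul, mul_zero] at hfx'
          exact hf0 hfx')
        have hlt : M < N := by
          rw [hfx', addVal_mul, addVal_mul, hα, hM, addVal_eq_zero_iff.mpr (hwu.pow b)] at hN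
          have : α + (M + 0) = N := by exact_mod_cast hN
          omega
        exact ih M hlt _ _ _ ⟨_, hmem⟩ d 0 hdom (by simp) hM fun _ ↦ Or.inr rfl
    · have hres : residue V w ∈ algebraicClosure K (ResidueField V) := by
        rw [residue_eq_zero_iff_not_isUnit.mpr hwu]
        exact zero_mem _
      have hdom := h.blowup hw hres (g := X) (by rwa [eval₂_X])
        (IsDominated.exists_div_of_not_isUnit hwu) hz
      obtain ⟨M, hM⟩ := exists_addVal_eq_natCast (V := V) (x := P.eval₂ S.subtype w) (by
        intro h0
        rw [hfx, ← hPw, h0, mul_zero] at hf0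
        exact hf0 rfl)
      have hlt : M < N := by
        rw [hfx, ← hPw, addVal_mul, hα, hM] at hN
        have : α + M = N := by exact_mod_cast hN
        omega
      refine ih M hlt _ _ _ ⟨_, eval₂_mem_blowupRing S.subtype w P⟩ d b hdom ?_ hM ?_
      · simp only [hPw, eval₂_X, Subring.subtype_apply]
      · rintro ⟨m, n, τ, ht⟩
        simp only [eval₂_X, Subring.subtype_apply] at ht
        exact (hnt ⟨m, n + m, τ, ht.of_blowup hw⟩).elim
  intro S x y f a b h hf hN ht
  by_cases hnt : ∃ m n τ, IsToric K (x : V) (y : V) m n τ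
  · obtain ⟨m, n, τ, htor⟩ := hnt
    rcases ht ⟨m, n, τ, htor⟩ with rfl | rfl
    · rw [pow_zero, mul_one] at hf
      exact h.symm.isPolynomialResidue_of_toric htor.symm hf
    · rw [pow_zero, mul_one] at hf
      exact h.isPolynomialResidue_of_toric htor hf
  · have hnt' : ¬ ∃ m n τ, IsToric K (y : V) (x : V) m n τ := fun ⟨m, n, τ, h⟩ ↦
      hnt ⟨n, m, τ⁻¹, h.symm⟩
    rcases ValuationRing.dvd_total (x : V) (y : V) with hd | hd
    · exact key S x y f a b h hf hN hnt hd
    · exact key S y x f b a h.symm (by rw [hf]; ring) hN hnt' hd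

end Induction

/-! ### Monomial valuations and toric divisors -/

section Monomial

open IsDiscreteValuationRing

variable {R V : Type*} [CommRing R] [IsLocalRing R] [CommRing V] [IsDomain V]
  [IsDiscreteValuationRing V] [Algebra R V] [IsLocalHom (algebraMap R V)]

/-- The parameters `x` and `y` are nonzero, as otherwise the maximal ideal of `R` would be principal
and all residues of `V` would come from `R`. -/
theorem isDominated_algebraMap {F : Type*} [Field F] [Algebra R F] [IsFractionRing R F]
    [Algebra V F] [IsFractionRing V F] [IsScalarTower R V F] {x y : R}
    (hxy : maximalIdeal R = Ideal.span {x, y}) {ρ : ResidueField V}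
    (hρ : Transcendental (ResidueField R) ρ) :
    IsDominated (ResidueField R) (algebraMap R V) x y := by
  have hinjV : Function.Injective (algebraMap V F) := IsFractionRing.injective V F
  have hinj : Function.Injective (algebraMap R V) := by
    have h : Function.Injective (algebraMap R F) := IsFractionRing.injective R F
    rw [IsScalarTower.algebraMap_eq R V F] at h
    exact Function.Injective.of_comp h
  have hloc : ∀ r, IsUnit (algebraMap R V r) → IsUnit r := fun r hr ↦ isUnit_of_map_unit _ r hr
  have hspan : ∀ r, ¬ IsUnit (algebraMap R V r) → r ∈ Ideal.span {x, y} := by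
    intro r hr
    rw [← hxy, mem_maximalIdeal, mem_nonunits_iff]
    exact fun h ↦ hr (h.map _)
  have hmem : ∀ r ∈ Ideal.span {x, y}, ¬ IsUnit (algebraMap R V r) := by
    intro r hr hu
    rw [← hxy] at hr
    exact hr (hloc r hu)
  have hx := hmem x (Ideal.subset_span (by simp))
  have hy := hmem y (Ideal.subset_span (by simp))
  have hfrac : ∀ u : V, ∃ p q : R, algebraMap R V q ≠ 0 ∧
      u * algebraMap R V q = algebraMap R V p := by
    intro u
    obtain ⟨p, q, hq, hpq⟩ := IsFractionRing.div_surjective (A := R) (algebraMap V F u)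
    have hq0 : algebraMap R F q ≠ 0 := IsLocalization.to_map_ne_zero_of_mem_nonZeroDivisors F
      le_rfl hq
    refine ⟨p, q, fun h0 ↦ hq0 ?_, hinjV ?_⟩
    · rw [IsScalarTower.algebraMap_apply R V F, h0, map_zero]
    · rw [map_mul, ← IsScalarTower.algebraMap_apply, ← IsScalarTower.algebraMap_apply, ← hpq,
        div_mul_cancel₀ _ hq0]
  have hres : ∀ r, residue V (algebraMap R V r) =
      algebraMap (ResidueField R) (ResidueField V) (residue R r) := fun r ↦
    (ResidueField.algebraMap_residue r).symm
  have hne : ∀ x y : R, maximalIdeal R = Ideal.span {x, y} → ¬ IsUnit (algebraMap R V y) →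
      algebraMap R V x ≠ 0 := by
    intro x y hxy hy hx0
    obtain rfl : x = 0 := hinj (by rw [hx0, map_zero])
    obtain ⟨u, rfl⟩ := residue_surjective ρ
    have hu : IsUnit u := by
      by_contra hu
      exact ne_zero_of_transcendental hρ (residue_eq_zero_iff_not_isUnit.mpr hu)
    obtain ⟨r, rfl⟩ := exists_map_eq_of_principal hloc (x := y) (fun r hr ↦ by
      have h : r ∈ maximalIdeal R := fun h ↦ hr (h.map _)
      rwa [hxy, Ideal.span_insert_zero] at h) hy hfrac hu
    rw [hres] at hρ
    exact hρ (isAlgebraic_algebraMap _)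
  exact
    { isUnit_of_map := hloc
      mem_span := hspan
      not_isUnit_left := hx
      not_isUnit_right := hy
      left_ne_zero := hne x y hxy hy
      right_ne_zero := hne y x (by rw [hxy, Set.pair_comm]) hx
      exists_frac := hfrac
      residue_mem := fun r ↦ by
        rw [hres]
        exact IntermediateField.algebraMap_mem _ _
      exists_residue_eq := fun k ↦ by
        obtain ⟨r, rfl⟩ := residue_surjective k
        exact ⟨r, hres r⟩ }

theorem IsToric.isMonomialVal {x y : R} {m n : ℕ} {τ : Vˣ}
    (h : IsDominated (ResidueField R) (algebraMap R V) x y)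
    (ht : IsToric (ResidueField R) (algebraMap R V x) (algebraMap R V y) m n τ) :
    IsMonomialVal R V x y := by
  obtain ⟨α, hα⟩ := exists_addVal_eq_natCast h.left_ne_zero
  obtain ⟨β, hβ⟩ := exists_addVal_eq_natCast h.right_ne_zero
  intro c hc
  simp only [divisorVal, hα, hβ]
  rcases c.support.eq_empty_or_nonempty with h0 | hne
  · rw [Finsupp.support_eq_empty.mp h0]
    simp [monomialSum]
  · obtain ⟨p, hp, hmin⟩ := Finset.exists_min_image c.support
      (fun p ↦ p.1 * α + p.2 * β) hne
    rw [h.addVal_monomialSum ht hα hβ c hmin ((hc p hp).map _)]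
    refine le_antisymm (Finset.le_inf fun q hq ↦ ?_) ?_
    · exact_mod_cast hmin q hq
    · exact (Finset.inf_le hp).trans (by push_cast; exact le_rfl)

/-- If `v` is monomial, then `V` is toric: a polynomial relation for the residue of `τ = y ^ m / x
^ n` would lift to a sum of monomials of equal value and with unit coefficients, whose value
exceeds that of its terms. -/
theorem IsMonomialVal.exists_isToric {x y : R}
    (h : IsDominated (ResidueField R) (algebraMap R V) x y) (hv : IsMonomialVal R V x y) :
    ∃ m n τ, IsToric (ResidueField R) (algebraMap R V x) (algebraMap R V y) m n τ := by
  obtain ⟨α, hα⟩ := exists_addVal_eq_natCast h.left_ne_zero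
  obtain ⟨β, hβ⟩ := exists_addVal_eq_natCast h.right_ne_zero
  have hα0 := pos_of_addVal_eq h.not_isUnit_left hα
  have hβ0 := pos_of_addVal_eq h.not_isUnit_right hβ
  obtain ⟨g, m, n, hg, hmn, rfl, rfl⟩ := Nat.exists_coprime' (Nat.gcd_pos_of_pos_left β hα0)
  have hm : 0 < m := Nat.pos_of_mul_pos_right hα0
  have hn : 0 < n := Nat.pos_of_mul_pos_right hβ0
  have hassoc : Associated (algebraMap R V x ^ n) (algebraMap R V y ^ m) := by
    rw [← addVal_eq_iff_associated, addVal_pow, addVal_pow, hα, hβ]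
    simp only [nsmul_eq_mul]
    norm_cast
    ring
  obtain ⟨τ, hτ⟩ := hassoc
  refine ⟨m, n, τ, hm, hn, hmn, by rw [← hτ, mul_comm], ?_⟩
  rintro ⟨P, hP, hroot⟩
  -- lift the coefficients of `P` to units or zero
  obtain ⟨σ, hσ⟩ : ∃ σ : ResidueField R → R, ∀ k, residue R (σ k) = k ∧ (σ k = 0 ↔ k = 0) := by
    classical
    refine ⟨fun k ↦ if k = 0 then 0 else (residue_surjective k).choose, fun k ↦ ?_⟩
    dsimp only
    split_ifs with hk
    · simp [hk]
    · have h1 := (residue_surjective (R := R) k).choose_spec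
      refine ⟨h1, fun h0 ↦ ?_, fun h0 ↦ (hk h0).elim⟩
      rw [h0, map_zero] at h1
      exact h1.symm
  have hσu : ∀ k, k ≠ 0 → IsUnit (σ k) := fun k hk ↦ by
    by_contra hu
    refine hk ?_
    rw [← (hσ k).1, residue_eq_zero_iff]
    exact hu
  set N := P.natDegree
  let e : ℕ ↪ ℕ × ℕ := ⟨fun i ↦ (n * (N - i), m * i), fun i j hij ↦
    Nat.eq_of_mul_eq_mul_left hm (congrArg Prod.snd hij)⟩
  let l : ℕ →₀ R := Finsupp.onFinset P.support (fun i ↦ σ (P.coeff i)) fun i hi ↦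
    Polynomial.mem_support_iff.mpr fun h0 ↦ hi ((hσ _).2.mpr h0)
  have hl : l.support = P.support := by
    ext i
    rw [Finsupp.mem_support_iff, Polynomial.mem_support_iff]
    exact not_congr (hσ _).2
  have hunit : ∀ p ∈ (l.embDomain e).support, IsUnit (l.embDomain e p) := by
    intro p hp
    rw [Finsupp.support_embDomain, Finset.mem_map] at hp
    obtain ⟨i, hi, rfl⟩ := hp
    rw [Finsupp.embDomain_apply_self]
    rw [hl, Polynomial.mem_support_iff] at hi
    exact hσu _ hi
  have hval := hv (l.embDomain e) hunit
  set w : V := ∑ i ∈ P.support, algebraMap R V (σ (P.coeff i)) * (τ : V) ^ i with hw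
  have hsum : algebraMap R V (monomialSum x y (l.embDomain e)) =
      algebraMap R V x ^ (n * N) * w := by
    rw [monomialSum, Finsupp.sum_embDomain, Finsupp.sum, hl, map_sum, hw, Finset.mul_sum]
    refine Finset.sum_congr rfl fun i hi ↦ ?_
    have hiN : i ≤ N := Polynomial.le_natDegree_of_mem_supp i hi
    obtain ⟨d, hd⟩ := Nat.exists_eq_add_of_le hiN
    have he1 : (e i).1 = n * d := by
      change n * (N - i) = n * d
      rw [hd, Nat.add_sub_cancel_left]
    have he2 : (e i).2 = m * i := rfl
    have hli : l i = σ (P.coeff i) := rfl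
    rw [he1, he2, hli, hd, map_mul, map_mul, map_pow, map_pow, pow_mul _ m i, ← hτ]
    ring
  have hw0 : residue V w = 0 := by
    rw [← hroot, hw, map_sum, Polynomial.aeval_eq_sum_range' (Nat.lt_succ_self _),
      ← Finset.sum_subset Polynomial.supp_subset_range_natDegree_succ]
    · refine Finset.sum_congr rfl fun i _ ↦ ?_
      rw [map_mul, map_pow, Algebra.smul_def, ← ResidueField.algebraMap_residue, (hσ _).1]
    · intro i _ hi
      rw [Polynomial.notMem_support_iff.mp hi, zero_smul]
  refine residue_eq_zero_iff_not_isUnit.mp hw0 (addVal_eq_zero_iff.mp ?_)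
  have hinf : ((l.embDomain e).support.inf fun p ↦
      (p.1 : ℕ∞) * divisorVal R V x + (p.2 : ℕ∞) * divisorVal R V y) ≤ (n * N * (m * g) : ℕ) := by
    have hNs : N ∈ P.support := Polynomial.natDegree_mem_support_of_nonzero hP
    have hmem : e N ∈ (l.embDomain e).support := by
      rw [Finsupp.support_embDomain, hl]
      exact Finset.mem_map_of_mem e hNs
    refine (Finset.inf_le hmem).trans ?_
    simp only [divisorVal, hα, hβ]
    have he1 : (e N).1 = 0 := by
      change n * (N - N) = 0
      rw [Nat.sub_self, mul_zero]
    have he2 : (e N).2 = m * N := rfl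
    rw [he1, he2]
    norm_cast
    apply le_of_eq
    ring
  rw [← hval, divisorVal, hsum, addVal_mul, addVal_pow, hα] at hinf
  cases hwv : addVal V w with
  | top =>
    rw [hwv, add_top, top_le_iff] at hinf
    exact absurd hinf (ENat.natCast_ne_top _)
  | coe k =>
    rw [hwv, nsmul_eq_mul] at hinf
    have : n * N * (m * g) + k ≤ n * N * (m * g) := by exact_mod_cast hinf
    have hk : k = 0 := by omega
    rw [hk, Nat.cast_zero]

end Monomial

/-! ### Residually polynomial functions -/

theorem isResiduallyPolynomial_iff {R V F : Type*} [CommRing R] [IsLocalRing R] [CommRing V]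
    [IsDomain V] [IsDiscreteValuationRing V] [Algebra R V] [IsLocalHom (algebraMap R V)] [Field F]
    [Algebra V F] [IsFractionRing V F] (w : V) :
    IsResiduallyPolynomial R V (algebraMap V F w) ↔
      IsPolynomialResidue (ResidueField R) (residue V w) := by
  constructor
  · rintro ⟨t, ht, _, ⟨w', hw', rfl⟩, hmem⟩
    obtain rfl := IsFractionRing.injective V F hw'
    exact ⟨t, ht, hmem⟩
  · rintro ⟨t, ht, hmem⟩
    exact ⟨t, ht, _, ⟨w, rfl, rfl⟩, hmem⟩

theorem mem_edgeExponents {R V : Type*} [CommRing R] [IsLocalRing R] [CommRing V]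
    [Algebra R V] [IsLocalHom (algebraMap R V)] {α β γ : ℕ} {c : ℕ × ℕ →₀ R} {b : ℕ} :
    b ∈ edgeExponents α β γ c ↔
      ∃ p : ℕ × ℕ, p.1 * α + p.2 * β = γ ∧ IsUnit (algebraMap R V (c p)) ∧ p.2 = b := by
  simp only [edgeExponents, Finset.mem_image, Finset.mem_filter, Finsupp.mem_support_iff,
    mem_maximalIdeal, mem_nonunits_iff, not_not, isUnit_map_iff]
  constructor
  · rintro ⟨p, ⟨-, hu, hw⟩, hb⟩
    exact ⟨p, hw, hu, hb⟩
  · rintro ⟨p, hw, hu, hb⟩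
    exact ⟨p, ⟨hu.ne_zero, hu, hw⟩, hb⟩

theorem mainTheorem2 {R V F : Type*} [CommRing R] [IsRegularLocalRing R]
    (hdim : ringKrullDim R = 2)
    [Field F] [Algebra R F] [IsFractionRing R F]
    [CommRing V] [IsDomain V] [IsDiscreteValuationRing V] [Algebra V F] [IsFractionRing V F]
    [Algebra R V] [IsScalarTower R V F] [IsLocalHom (algebraMap R V)]
    (z : F) (hz : z ≠ 0) (hdic : IsDicriticalDivisor R V z)
    (x y : R) (hxy : maximalIdeal R = Ideal.span {x, y})
    (a₀ b₀ : ℕ) (f : R)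
    (hf : algebraMap R F f = z * algebraMap R F x ^ a₀ * algebraMap R F y ^ b₀) :
    (¬ IsMonomialVal R V x y → IsResiduallyPolynomial R V z) ∧
    (IsMonomialVal R V x y →
      ∃ α β : ℕ, 0 < α ∧ 0 < β ∧ divisorVal R V x = α ∧ divisorVal R V y = β ∧
        divisorVal R V f = ((a₀ * α + b₀ * β : ℕ) : ℕ∞) ∧
        (∃ c : ℕ × ℕ →₀ R, IsExpansion x y f α β (a₀ * α + b₀ * β) c) ∧
        ∀ c : ℕ × ℕ →₀ R, IsExpansion x y f α β (a₀ * α + b₀ * β) c →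
          (edgeExponents α β (a₀ * α + b₀ * β) c).Nonempty ∧
          (2 ≤ (edgeExponents α β (a₀ * α + b₀ * β) c).card →
            (IsResiduallyPolynomial R V z ↔
              (b₀ : WithTop ℕ) ≤ (edgeExponents α β (a₀ * α + b₀ * β) c).min ∨
              (edgeExponents α β (a₀ * α + b₀ * β) c).max ≤ (b₀ : WithBot ℕ))) ∧
          (∀ b₁ : ℕ, edgeExponents α β (a₀ * α + b₀ * β) c = {b₁} →
            b₀ ≠ b₁ ∧ IsResiduallyPolynomial R V z)) := by
  obtain ⟨_, ⟨w, rfl, rfl⟩, hρ⟩ := hdic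
  have h := isDominated_algebraMap (F := F) hxy hρ
  have hfw : algebraMap R V f = w * algebraMap R V x ^ a₀ * algebraMap R V y ^ b₀ := by
    refine IsFractionRing.injective V F ?_
    simp only [map_mul, map_pow, ← IsScalarTower.algebraMap_apply]
    exact hf
  have hwu : IsUnit w := by
    by_contra hu
    exact ne_zero_of_transcendental hρ (residue_eq_zero_iff_not_isUnit.mpr hu)
  simp only [isResiduallyPolynomial_iff]
  refine ⟨fun hnm ↦ ?_, fun hm ↦ ?_⟩
  · have hf0 : algebraMap R V f ≠ 0 := hfw ▸ mul_ne_zero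
      (mul_ne_zero hwu.ne_zero (pow_ne_zero _ h.left_ne_zero)) (pow_ne_zero _ h.right_ne_zero)
    obtain ⟨N, hN⟩ := exists_addVal_eq_natCast hf0
    exact isPolynomialResidue_of_not_toric hρ N _ _ _ ((algebraMap R V).rangeRestrict f) a₀ b₀
      h.map_range hfw hN fun ⟨m, n, τ, ht⟩ ↦ (hnm (ht.isMonomialVal h)).elim
  obtain ⟨m, n, τ, ht⟩ := hm.exists_isToric h
  obtain ⟨α, hα⟩ := exists_addVal_eq_natCast h.left_ne_zero
  obtain ⟨β, hβ⟩ := exists_addVal_eq_natCast h.right_ne_zero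
  have hα0 := pos_of_addVal_eq h.not_isUnit_left hα
  have hβ0 := pos_of_addVal_eq h.not_isUnit_right hβ
  have hfv : IsDiscreteValuationRing.addVal V (algebraMap R V f) =
      (a₀ * α + b₀ * β : ℕ) := by
    rw [hfw, mul_assoc, IsDiscreteValuationRing.addVal_mul, addVal_monomial hα hβ,
      IsDiscreteValuationRing.addVal_eq_zero_iff.mpr hwu, zero_add]
  refine ⟨α, β, hα0, hβ0, hα, hβ, hfv, h.exists_isExpansion ht hα hβ f _ hfv.ge, fun c hc ↦ ?_⟩
  have hB : ∀ b, b ∈ edgeExponents α β (a₀ * α + b₀ * β) c ↔ ∃ p : ℕ × ℕ,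
      p.1 * α + p.2 * β = a₀ * α + b₀ * β ∧ IsUnit (algebraMap R V (c p)) ∧ p.2 = b := fun b ↦
    mem_edgeExponents
  have hle : (∀ b ∈ edgeExponents α β (a₀ * α + b₀ * β) c, b₀ ≤ b) →
      IsPolynomialResidue (ResidueField R) (residue V w) := fun hle ↦
    h.isPolynomialResidue_of_le ht hα hβ hfw hc fun p hp hu ↦ hle _ ((hB _).mpr ⟨p, hp, hu, rfl⟩)
  have hge : (∀ b ∈ edgeExponents α β (a₀ * α + b₀ * β) c, b ≤ b₀) →
      IsPolynomialResidue (ResidueField R) (residue V w) := fun hge ↦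
    h.isPolynomialResidue_of_ge ht hα hβ hfw hc fun p hp hu ↦ hge _ ((hB _).mpr ⟨p, hp, hu, rfl⟩)
  -- if every leading term were a constant multiple of `x ^ a₀ y ^ b₀`, the residue would be
  -- algebraic over the residue field of `R`
  have hconst : ¬ ∀ b ∈ edgeExponents α β (a₀ * α + b₀ * β) c, b = b₀ := by
    intro hall
    refine hρ (mem_algebraicClosure_iff.mp ?_)
    rw [h.residue_eq_sum ht hα hβ hfw hc]
    refine sum_mem fun p hp ↦ ?_
    by_cases hu : IsUnit (algebraMap R V (c p))
    · rw [hall p.2 ((hB _).mpr ⟨p, (Finset.mem_filter.mp hp).2, hu, rfl⟩), sub_self,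
        Int.zero_ediv, zpow_zero, mul_one]
      exact h.residue_mem _
    · rw [residue_eq_zero_iff_not_isUnit.mpr hu, zero_mul]
      exact zero_mem _
  refine ⟨?_, fun _ ↦ ⟨fun hpol ↦ ?_, ?_⟩, fun b₁ hb₁ ↦ ⟨?_, ?_⟩⟩
  · by_contra hne
    rw [Finset.not_nonempty_iff_eq_empty] at hne
    exact hconst (by simp [hne])
  · by_contra! hnot
    obtain ⟨hmin, hmax⟩ := hnot
    rw [← not_le, Finset.le_min_iff] at hmin
    rw [← not_le] at hmax
    have hmax' := mt (Finset.max_le (s := edgeExponents α β (a₀ * α + b₀ * β) c)) hmax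
    push Not at hmin hmax'
    obtain ⟨b, hb, hbl⟩ := hmin
    obtain ⟨b', hb', hbg⟩ := hmax'
    obtain ⟨p, hp, hu, rfl⟩ := (hB b).mp hb
    obtain ⟨q, hq, hu', rfl⟩ := (hB b').mp hb'
    exact h.not_isPolynomialResidue ht hα hβ hfw hc ⟨p, hp, hu, WithTop.coe_lt_coe.mp hbl⟩
      ⟨q, hq, hu', WithBot.coe_lt_coe.mp hbg⟩ hpol
  · rintro (hmin | hmax)
    · exact hle fun b hb ↦ WithTop.coe_le_coe.mp (Finset.le_min_iff.mp hmin b hb)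
    · exact hge fun b hb ↦ WithBot.coe_le_coe.mp ((Finset.le_max hb).trans hmax)
  · rintro rfl
    exact hconst (by simp [hb₁])
  · rcases le_total b₀ b₁ with hb | hb
    · exact hle (by simpa [hb₁] using hb)
    · exact hge (by simpa [hb₁] using hb)
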